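/- Let $k$ be a field and let $\mathcal{C}$ be a $k$-linear, Hom-finite triangulated category with split idempotents and suspension functor $\Sigma$. Let $d\geq 1$ be an integer and let $\mathcal{S}\subseteq\mathcal{C}$ be a $d$-cluster tilting subcategory, that is, a functorially finite full subcategory with $$\mathcal{S}=\{X\in\mathcal{C}\mid \mathcal{C}(\mathcal{S},\Sigma^iX)=0 \text{ for } 1\leq i\leq d-1\}=\{X\in\mathcal{C}\mid \mathcal{C}(X,\Sigma^i\mathcal{S})=0 \text{ for } 1\leq i\leq d-1\}.$$ Assume that $\Sigma^d\mathcal{S}=\mathcal{S}$. A $(d+2)$-angle in $\mathcal{S}$ is a sequence $S_{d+1}\to S_d\to\cdots\to S_0\to\Sigma^dS_{d+1}$ with all $S_i\in\mathcal{S}$ for which there are triangles $Y_{l+1}\to S_{l+1}\to Y_l\to\Sigma Y_{l+1}$ in $\mathcal{C}$ ($0\leq l\leq d-1$, $Y_0=S_0$, $Y_d=S_{d+1}$) such that $S_{l+1}\to S_l$ is the composite $S_{l+1}\to Y_l\to S_l$ for $0\le l\le d$ (where $S_{d+1}\to Y_d$ and $Y_0\to S_0$ are identities) and $S_0\to\Sigma^dS_{d+1}$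 is the composite $Y_0\to\Sigma Y_1\to\cdots\to\Sigma^dY_d$. Let $K_0^{sp}(\mathcal{S})$ be the split Grothendieck group of $\mathcal{S}$, let $R\subseteq K_0^{sp}(\mathcal{S})$ be the subgroup generated by the elements $\sum_{i=0}^{d+1}(-1)^i[S_i]$ for all $(d+2)$-angles in $\mathcal{S}$, let $K_0(\mathcal{S})=K_0^{sp}(\mathcal{S})/R$, and let $K_0(\mathcal{C})$ be the Grothendieck group of the triangulated category $\mathcal{C}$. (1) The inclusion $\mathcal{S}\subseteq\mathcal{C}$ induces an isomorphism $K_0(\mathcal{S})\cong K_0(\mathcal{C})$, $[X]\mapsto[X]$. (2) Assume $d\geq 2$. Every $X\in\mathcal{C}$ admits triangles $X_{l+1}\to U_l\xrightarrow{\mu_l}X_l\to\Sigma X_{l+1}$ ($0\leq l\leq d-2$, $X_0=X$) with all $\mu_l$ being $\mathcal{S}$-covers and $U_{d-1}:=X_{d-1}\in\mathcal{S}$, and $\mathrm{index}_{\mathcal{S}}(X)=\sum_{i=0}^{d-1}(-1)^i[U_i]\in K_0^{sp}(\mathcal{S})$ depends only on $X$. For an object $N$ put $F_{\mathcal{S}}N=\mathcal{C}(-,N)|_{\mathcal{S}}$,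 and let $\mathcal{S}*\Sigma\mathcal{S}$ be the class of those $N$ for which there is a triangle $A\to N\to\Sigma B\to\Sigma A$ with $A,B\in\mathcal{S}$. Let $K_0(\mathrm{mod}\,\mathcal{S})$ be the Grothendieck group of the abelian category $\mathrm{mod}\,\mathcal{S}$ of coherent $\mathcal{S}$-modules, that is, of those contravariant $k$-linear functors $G$ from $\mathcal{S}$ to $k$-vector spaces that admit an exact sequence $\mathcal{S}(-,U_1)\to\mathcal{S}(-,U_0)\to G\to 0$ with $U_0,U_1\in\mathcal{S}$. Then $F_{\mathcal{S}}N\in\mathrm{mod}\,\mathcal{S}$ for all $N\in\mathcal{S}*\Sigma\mathcal{S}$, there is a unique homomorphism $\theta_{\mathcal{S}}:K_0(\mathrm{mod}\,\mathcal{S})\to K_0^{sp}(\mathcal{S})$ with $\theta_{\mathcal{S}}([F_{\mathcal{S}}N])=\mathrm{index}_{\mathcal{S}}(\Sigma^{-1}N)+\mathrm{index}_{\mathcal{S}}(N)$ for all $N\in\mathcal{S}*\Sigma\mathcal{S}$, and $\operatorname{im}\theta_{\mathcal{S}}=R$. -/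

import Mathlib

open CategoryTheory CategoryTheory.Limits CategoryTheory.Pretriangulated

universe w v u

noncomputable section

namespace ClusterK0

/-! ### Split Grothendieck groups and Grothendieck groups of triangulated categories -/

section Split

variable (A : Type u) [Category.{v} A]

/-- The free abelian group `G(A)` on the isomorphism classes of objects of `A`. -/
abbrev FreeOnIsoClasses : Type u := FreeAbelianGroup (Quotient (isIsomorphicSetoid A))

variable {A} in
/-- The generator of `G(A)` given by the isomorphism class of `X`. -/
def freeClass (X : A) : FreeOnIsoClasses A :=
  FreeAbelianGroup.of (Quotient.mk (isIsomorphicSetoid A) X)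

variable [Preadditive A]

/-- The subgroup of `G(A)` generated by the elements `[X ⊕ Y] - [X] - [Y]`. -/
def splitRelations : AddSubgroup (FreeOnIsoClasses A) :=
  AddSubgroup.closure
    {z | ∃ (X Y : A) (b : BinaryBicone X Y), Nonempty b.IsBilimit ∧
      z = freeClass b.pt - freeClass X - freeClass Y}

/-- The split Grothendieck group `K₀ˢᵖ(A)`. -/
abbrev K0Split : Type u := FreeOnIsoClasses A ⧸ splitRelations A

variable {A} in
/-- The class `[X]` in `K₀ˢᵖ(A)`. -/
def splitClass (X : A) : K0Split A := QuotientAddGroup.mk (freeClass X)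

end Split

section Triangulated

variable (C : Type u) [Category.{v} C] [Preadditive C] [HasZeroObject C] [HasShift C ℤ]
  [∀ n : ℤ, (shiftFunctor C n).Additive] [Pretriangulated C]

/-- The subgroup of `K₀ˢᵖ(C)` generated by the `[X] - [Y] + [Z]`, for the distinguished triangles
`X ⟶ Y ⟶ Z ⟶ ΣX`. -/
def triangleRelations : AddSubgroup (K0Split C) :=
  AddSubgroup.closure
    {z | ∃ T : Triangle C, T ∈ distTriang C ∧
      z = splitClass T.obj₁ - splitClass T.obj₂ + splitClass T.obj₃}

/-- The Grothendieck group `K₀(C)` of a triangulated category. -/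
abbrev K0Triangulated : Type u := K0Split C ⧸ triangleRelations C

variable {C} in
/-- The class `[X]` in `K₀(C)`. -/
def triangulatedClass (X : C) : K0Triangulated C := QuotientAddGroup.mk (splitClass X)

end Triangulated

/-! ### Covers and cluster tilting subcategories -/

section Approximations

variable {C : Type u} [Category.{v} C] (S : ObjectProperty C)

/-- `μ : U ⟶ X` is an `S`-precover. -/
def IsPrecover {U X : C} (μ : U ⟶ X) : Prop :=
  S U ∧ ∀ (U' : C), S U' → ∀ μ' : U' ⟶ X, ∃ φ : U' ⟶ U, φ ≫ μ = μ'

/-- `ν : X ⟶ U` is an `S`-preenvelope. -/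
def IsPreenvelope {X U : C} (ν : X ⟶ U) : Prop :=
  S U ∧ ∀ (U' : C), S U' → ∀ ν' : X ⟶ U', ∃ φ : U ⟶ U', ν ≫ φ = ν'

/-- An `S`-cover is a right minimal `S`-precover. -/
def IsCover {U X : C} (μ : U ⟶ X) : Prop :=
  IsPrecover S μ ∧ ∀ φ : U ⟶ U, φ ≫ μ = μ → IsIso φ

/-- `S` is functorially finite: it is precovering and preenveloping. -/
def IsFunctoriallyFinite : Prop :=
  (∀ X : C, ∃ (U : C) (μ : U ⟶ X), IsPrecover S μ) ∧
    (∀ X : C, ∃ (U : C) (ν : X ⟶ U), IsPreenvelope S ν)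

variable [Preadditive C] [HasShift C ℤ]

/-- `S` is `m`-cluster tilting: it is functorially finite and consists of the objects `X` with
`Extⁱ(S, X) = 0` for `1 ≤ i ≤ m - 1`, and also of the objects `X` with `Extⁱ(X, S) = 0` for
`1 ≤ i ≤ m - 1`, where `Extⁱ(X, Y) = Hom(X, Σⁱ Y)`. -/
structure IsClusterTilting (m : ℕ) : Prop where
  functoriallyFinite : IsFunctoriallyFinite S
  mem_iff_right : ∀ X : C, S X ↔
    ∀ U : C, S U → ∀ i : ℕ, 1 ≤ i → i < m → ∀ f : U ⟶ X⟦(i : ℤ)⟧, f = 0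
  mem_iff_left : ∀ X : C, S X ↔
    ∀ U : C, S U → ∀ i : ℕ, 1 ≤ i → i < m → ∀ f : X ⟶ U⟦(i : ℤ)⟧, f = 0

end Approximations

/-! ### The `(d+2)`-angles of `S` and the Grothendieck group `K₀(S)` -/

section Angles

variable {C : Type u} [Category.{v} C] [Preadditive C] [HasZeroObject C] [HasShift C ℤ]
  [∀ n : ℤ, (shiftFunctor C n).Additive] [Pretriangulated C]

/-- A sequence `S_{d+1} ⟶ S_d ⟶ ⋯ ⟶ S_0 ⟶ Σᵈ S_{d+1}` with all `S_i` in `S`. -/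
structure AngleSequence (S : ObjectProperty C) (d : ℕ) where
  obj : Fin (d + 2) → S.FullSubcategory
  map : ∀ l : Fin (d + 1), (obj l.succ).obj ⟶ (obj l.castSucc).obj
  conn : (obj 0).obj ⟶ (obj (Fin.last (d + 1))).obj⟦(d : ℤ)⟧

/-- For a sequence of morphisms `δ_l : Y_l ⟶ ΣY_{l+1}`, the composite
`Y_0 ⟶ ΣY_1 ⟶ ⋯ ⟶ Σˡ Y_l` of the morphisms `Σʲ δ_j`. -/
def lowerEdge {d : ℕ} (Y : Fin (d + 1) → C)
    (δ : ∀ l : Fin d, Y l.castSucc ⟶ (Y l.succ)⟦(1 : ℤ)⟧) :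
    ∀ (l : ℕ) (hl : l < d + 1), Y 0 ⟶ (Y ⟨l, hl⟩)⟦(l : ℤ)⟧
  | 0, _ => (shiftFunctorZero' C ((0 : ℕ) : ℤ) (by simp)).inv.app (Y 0)
  | l + 1, hl =>
      lowerEdge Y δ l (by omega) ≫
        (shiftFunctor C (l : ℤ)).map (δ ⟨l, by omega⟩) ≫
        (shiftFunctorAdd' C (1 : ℤ) (l : ℤ) ((l + 1 : ℕ) : ℤ)
          (by push_cast; ring)).inv.app (Y ⟨l + 1, hl⟩)

/-- A tower of triangles realizing a sequence `s`. The lower row consists of objects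
`Y_0 ≅ S_0`, `Y_1`, …, `Y_{d-1}`, `Y_d ≅ S_{d+1}` (the isomorphisms are `inj 0` and
`proj (Fin.last d)`), there are distinguished triangles
`Y_{l+1} ⟶ S_{l+1} ⟶ Y_l ⟶ ΣY_{l+1}` for `0 ≤ l < d`, each morphism `S_{l+1} ⟶ S_l` of `s`
is the composite `S_{l+1} ⟶ Y_l ⟶ S_l`, and the last morphism `S_0 ⟶ Σᵈ S_{d+1}` of `s` is the
composite along the lower edge. -/
structure AngleTower {S : ObjectProperty C} {d : ℕ} (s : AngleSequence S d) where
  Y : Fin (d + 1) → C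
  inj : ∀ l : Fin (d + 1), Y l ⟶ (s.obj l.castSucc).obj
  proj : ∀ l : Fin (d + 1), (s.obj l.succ).obj ⟶ Y l
  δ : ∀ l : Fin d, Y l.castSucc ⟶ (Y l.succ)⟦(1 : ℤ)⟧
  isIso_inj : IsIso (inj 0)
  isIso_proj : IsIso (proj (Fin.last d))
  distinguished : ∀ l : Fin d,
    Triangle.mk (inj l.succ) (proj l.castSucc) (δ l) ∈ distTriang C
  map_eq : ∀ l : Fin (d + 1), s.map l = proj l ≫ inj l
  conn_eq : inj 0 ≫ s.conn ≫ (shiftFunctor C (d : ℤ)).map (proj (Fin.last d)) =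
    lowerEdge Y δ d (Nat.lt_succ_self d)

/-- The `(d+2)`-angles of `S` are the sequences realized by a tower of triangles of `C`. -/
def IsAngle {S : ObjectProperty C} {d : ℕ} (s : AngleSequence S d) : Prop :=
  Nonempty (AngleTower s)

variable (S : ObjectProperty C) (d : ℕ)

/-- The subgroup of `K₀ˢᵖ(S)` generated by the alternating sums `∑_{i=0}^{d+1} (-1)ⁱ [S_i]` of the
terms of the `(d+2)`-angles of `S`. -/
def angleRelations : AddSubgroup (K0Split S.FullSubcategory) :=
  AddSubgroup.closure
    {z | ∃ s : AngleSequence S d, IsAngle s ∧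
      z = ∑ i : Fin (d + 2), (-1 : ℤ) ^ (i : ℕ) • splitClass (s.obj i)}

/-- The Grothendieck group `K₀(S)` of the `(d+2)`-angulated category `S`. -/
abbrev K0Angulated : Type u := K0Split S.FullSubcategory ⧸ angleRelations S d

variable {S} in
/-- The class `[X]` in `K₀(S)`. -/
def angulatedClass (X : S.FullSubcategory) : K0Angulated S d :=
  QuotientAddGroup.mk (splitClass X)

end Angles

/-! ### The index -/

section Index

variable {C : Type u} [Category.{v} C] [Preadditive C] [HasZeroObject C] [HasShift C ℤ]
  [∀ n : ℤ, (shiftFunctor C n).Additive] [Pretriangulated C]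

/-- A tower of triangles `X_{l+1} ⟶ U_l ⟶ X_l ⟶ ΣX_{l+1}`, `0 ≤ l < n`, with `X_0 ≅ X`,
all `U_l` in `S`, all `μ_l : U_l ⟶ X_l` with `l < n` being `S`-covers, and `U_n ≅ X_n`. -/
structure IndexTower (S : ObjectProperty C) (n : ℕ) (X : C) where
  U : Fin (n + 1) → S.FullSubcategory
  Y : Fin (n + 1) → C
  iso : Y 0 ≅ X
  μ : ∀ l : Fin (n + 1), (U l).obj ⟶ Y l
  ι : ∀ l : Fin n, Y l.succ ⟶ (U l.castSucc).obj
  δ : ∀ l : Fin n, Y l.castSucc ⟶ (Y l.succ)⟦(1 : ℤ)⟧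
  isCover : ∀ l : Fin n, IsCover S (μ l.castSucc)
  isIso_μ : IsIso (μ (Fin.last n))
  distinguished : ∀ l : Fin n, Triangle.mk (ι l) (μ l.castSucc) (δ l) ∈ distTriang C

/-- The element `∑_{i=0}^{n} (-1)ⁱ [U_i]` of `K₀ˢᵖ(S)` given by a tower. -/
def IndexTower.value {S : ObjectProperty C} {n : ℕ} {X : C} (t : IndexTower S n X) :
    K0Split S.FullSubcategory :=
  ∑ i : Fin (n + 1), (-1 : ℤ) ^ (i : ℕ) • splitClass (t.U i)

/-- `x` is the alternating sum `∑_{i=0}^{m-1} (-1)ⁱ [U_i]` for some tower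
`U_{m-1} ⟶ U_{m-2} ⟶ ⋯ ⟶ U_0 ⟶ X` of `m - 1` triangles as above. -/
def IsIndex (S : ObjectProperty C) (m : ℕ) (X : C) (x : K0Split S.FullSubcategory) : Prop :=
  ∃ n : ℕ, m = n + 1 ∧ ∃ t : IndexTower S n X, x = t.value

/-- `ind` is the index with respect to the `m`-cluster tilting subcategory `S`: every object `X`
has a tower as above, and `ind X` is the value of every such tower. -/
def IsIndexFunction (S : ObjectProperty C) (m : ℕ) (ind : C → K0Split S.FullSubcategory) : Prop :=
  ∀ (X : C) (x : K0Split S.FullSubcategory), IsIndex S m X x ↔ x = ind X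

end Index

/-! ### Coherent `S`-modules and the homomorphism `θ` -/

section Modules

variable (k : Type w) [Field k] {C : Type u} [Category.{v} C] [Preadditive C] [Linear k C]
  (S : ObjectProperty C)

/-- The functor `F_S(X) = Hom(-, X)|_S`. For `X` in `S` it is the representable `S`-module. -/
def restrictedYoneda (X : C) : S.FullSubcategoryᵒᵖ ⥤ ModuleCat.{v} k :=
  S.ι.op ⋙ (linearYoneda k C).obj X

/-- `G` is a coherent `S`-module: a contravariant `k`-linear functor from `S` to `k`-modules for
which there is an exact sequence `S(-, U₁) ⟶ S(-, U₀) ⟶ G ⟶ 0` with `U₁, U₀` in `S`. -/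
structure IsCoherent (G : S.FullSubcategoryᵒᵖ ⥤ ModuleCat.{v} k) : Prop where
  additive : G.Additive
  linear : ∀ {X Y : S.FullSubcategory} (r : k) (f : X ⟶ Y), G.map (r • f).op = r • G.map f.op
  presentation : ∃ (U₁ U₀ : S.FullSubcategory)
    (f : restrictedYoneda k S U₁.obj ⟶ restrictedYoneda k S U₀.obj)
    (p : restrictedYoneda k S U₀.obj ⟶ G),
    ∀ X : S.FullSubcategoryᵒᵖ,
      Function.Exact (f.app X).hom (p.app X).hom ∧ Function.Surjective (p.app X).hom

/-- The category `mod S` of coherent `S`-modules. -/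
abbrev CoherentModules : Type (max w u v (v + 1)) :=
  ObjectProperty.FullSubcategory
    (fun G : S.FullSubcategoryᵒᵖ ⥤ ModuleCat.{v} k => IsCoherent k S G)

variable {k S} in
/-- `0 ⟶ M₁ ⟶ M₂ ⟶ M₃ ⟶ 0` is a short exact sequence of `S`-modules; exactness is objectwise. -/
def IsShortExact {M₁ M₂ M₃ : CoherentModules k S} (f : M₁ ⟶ M₂) (g : M₂ ⟶ M₃) : Prop :=
  ∀ X : S.FullSubcategoryᵒᵖ,
    Function.Injective (f.hom.app X).hom ∧
    Function.Exact (f.hom.app X).hom (g.hom.app X).hom ∧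
    Function.Surjective (g.hom.app X).hom

/-- The subgroup of `K₀ˢᵖ(mod S)` generated by the `[M₁] - [M₂] + [M₃]`, for the short exact
sequences `0 ⟶ M₁ ⟶ M₂ ⟶ M₃ ⟶ 0` of coherent `S`-modules. -/
def exactRelations : AddSubgroup (K0Split (CoherentModules k S)) :=
  AddSubgroup.closure
    {z | ∃ (M₁ M₂ M₃ : CoherentModules k S) (f : M₁ ⟶ M₂) (g : M₂ ⟶ M₃), IsShortExact f g ∧
      z = splitClass M₁ - splitClass M₂ + splitClass M₃}

/-- The Grothendieck group `K₀(mod S)` of the abelian category `mod S`. -/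
abbrev K0Mod := K0Split (CoherentModules k S) ⧸ exactRelations k S

variable {k S} in
/-- The class `[M]` in `K₀(mod S)`. -/
def modClass (M : CoherentModules k S) : K0Mod k S := QuotientAddGroup.mk (splitClass M)

variable [HasZeroObject C] [HasShift C ℤ] [∀ n : ℤ, (shiftFunctor C n).Additive]
  [Pretriangulated C]

variable {S} in
/-- The defining property of `θ_S : K₀(mod S) ⟶ K₀ˢᵖ(S)` (where `ind` is the index): for every `N`
in `S * ΣS`, i.e. sitting in a triangle `A ⟶ N ⟶ ΣB ⟶ ΣA` with `A`, `B` in `S`, the module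
`F_S(N)` is coherent and `θ_S [F_S N] = ind (Σ⁻¹ N) + ind N`. -/
def IsTheta (ind : C → K0Split S.FullSubcategory)
    (θ : K0Mod k S →+ K0Split S.FullSubcategory) : Prop :=
  ∀ N : C, S.extensionProduct (S.map (shiftFunctor C (1 : ℤ))) N →
    ∃ h : IsCoherent k S (restrictedYoneda k S N),
      θ (modClass ⟨restrictedYoneda k S N, h⟩) = ind (N⟦(-1 : ℤ)⟧) + ind N

end Modules

end ClusterK0

end

open ClusterK0

/-!
# The Grothendieck group of a `d`-cluster tilting subcategory

Everything rests on resolutions: an object `X` has triangles `X_{l+1} ⟶ U_l ⟶ X_l ⟶ ΣX_{l+1}` with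
`U_l ⟶ X_l` an `S`-precover, and after `d - 1` steps the remaining object lies in `S`
(`exists_hasResolution`). As `Hom(S, ΣX_{l+1}) = 0`, a horseshoe lemma holds for the triangles
`X ⟶ Y ⟶ Z ⟶ ΣX` on which every composite `V ⟶ Z ⟶ ΣX` with `V` in `S` vanishes
(`HasResolution.add`), and with homotopy pullbacks this gives Schanuel's lemma
(`HasResolution.unique`). So the alternating sum of a resolution only depends on `X`; this is the
index. Minimal resolutions, by covers, exist because the precovers of `X` with an endomorphism
algebra of minimal dimension are covers (`exists_isCover`).

An angle is the same thing as a resolution of length `d`, by arbitrary morphisms, of an object of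
`S`; in particular a triangle `T ⟶ P ⟶ Q ⟶ ΣT` with `P`, `Q` in `S` gives
`[Q] - [P] + index T ∈ R`. Two homotopy pullbacks along precovers reduce an arbitrary triangle to
this case, so that the index is additive modulo `R` (`index_mem_angleRelations`). Hence it induces a
map `K₀(C) ⟶ K₀(S)`, which is inverse to the one induced by the inclusion.

For the map `θ`, the point is that the sum `index (Σ⁻¹N) + index N` only depends on `F_S N`
(`indexSum_eq_of_bijective`): if `W ⟶ N ⟶ K ⟶ ΣW` is a triangle and `F_S N ⟶ F_S K` is bijective,
the index is additive on it and on `Σ⁻¹N ⟶ Σ⁻¹K ⟶ W ⟶ N`, and the two contributions of `W` cancel.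
Each coherent module is `F_S N` for the cone `N` of a morphism in `S`, and morphisms of modules lift
to such cones. A short exact sequence `0 ⟶ M₁ ⟶ M₂ ⟶ F_S N₃ ⟶ 0` with `M₂ = F_S N₂` comes from a
triangle `K ⟶ N₂ ⊕ ΣQ ⟶ N₃ ⟶ ΣK`, where `Q` is a precover of `Σ⁻¹N₃`: the summand `ΣQ` is invisible
to `F_S` and makes `F_S K ⟶ F_S N₂` injective (`indexSum_of_exact`). So `θ` is well defined, and on
the cone of `U₁ ⟶ U₀` its value is the alternating sum of the angle starting with `U₁ ⟶ U₀`, whence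
its image is `R`.
-/

namespace ClusterK0

/-! ### Classes in split Grothendieck groups -/

section SplitClasses

variable {A : Type u} [Category.{v} A]

lemma freeClass_congr {X Y : A} (e : X ≅ Y) : freeClass X = freeClass Y :=
  congrArg FreeAbelianGroup.of (Quotient.sound ⟨e⟩)

variable [Preadditive A]

lemma splitClass_congr {X Y : A} (e : X ≅ Y) : splitClass X = splitClass Y :=
  congrArg QuotientAddGroup.mk (freeClass_congr e)

lemma splitClass_bicone {X Y : A} (b : BinaryBicone X Y) (hb : b.IsBilimit) :
    splitClass b.pt = splitClass X + splitClass Y := by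
  have h : freeClass b.pt - freeClass X - freeClass Y ∈ splitRelations A :=
    AddSubgroup.subset_closure ⟨X, Y, b, ⟨hb⟩, rfl⟩
  have h' := (QuotientAddGroup.eq_zero_iff _).2 h
  rw [QuotientAddGroup.mk_sub, QuotientAddGroup.mk_sub, sub_sub, sub_eq_zero] at h'
  exact h'

lemma splitClass_eq_zero {X : A} (hX : IsZero X) : splitClass X = 0 := by
  let b : BinaryBicone X X :=
    { pt := X, fst := 𝟙 X, snd := 𝟙 X, inl := 𝟙 X, inr := 𝟙 X
      inl_snd := hX.eq_of_src _ _, inr_fst := hX.eq_of_src _ _ }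
  have h := splitClass_bicone b (isBinaryBilimitOfTotal b (hX.eq_of_src _ _))
  exact left_eq_add.1 h

/-- The homomorphism out of `K₀ˢᵖ(A)` given by an isomorphism invariant function on objects that is
additive on biproducts. -/
def splitLift {G : Type*} [AddCommGroup G] (f : A → G)
    (hf : ∀ {X Y : A}, (X ≅ Y) → f X = f Y)
    (hb : ∀ {X Y : A} (b : BinaryBicone X Y), b.IsBilimit → f b.pt = f X + f Y) :
    K0Split A →+ G :=
  QuotientAddGroup.lift (splitRelations A)
    (FreeAbelianGroup.lift (Quotient.lift f fun X Y (h : Nonempty (X ≅ Y)) => h.elim hf)) <| by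
      refine (AddSubgroup.closure_le _).2 ?_
      rintro _ ⟨X, Y, b, ⟨hbl⟩, rfl⟩
      change FreeAbelianGroup.lift
        (Quotient.lift f fun X Y (h : Nonempty (X ≅ Y)) => h.elim hf) _ = 0
      simp only [map_sub, freeClass, FreeAbelianGroup.lift_apply_of]
      change f b.pt - f X - f Y = 0
      rw [hb b hbl]
      abel

@[simp]
lemma splitLift_splitClass {G : Type*} [AddCommGroup G] (f : A → G)
    (hf : ∀ {X Y : A}, (X ≅ Y) → f X = f Y)
    (hb : ∀ {X Y : A} (b : BinaryBicone X Y), b.IsBilimit → f b.pt = f X + f Y) (X : A) :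
    splitLift f hf hb (splitClass X) = f X :=
  FreeAbelianGroup.lift_apply_of _ _

lemma splitClass_induction {p : K0Split A → Prop} (x : K0Split A)
    (zero : p 0) (of : ∀ X, p (splitClass X)) (sub : ∀ x y, p x → p y → p (x - y)) : p x := by
  have neg : ∀ y, p y → p (-y) := fun y hy => by simpa using sub 0 y zero hy
  obtain ⟨x, rfl⟩ := QuotientAddGroup.mk_surjective x
  induction x using FreeAbelianGroup.induction_on with
  | zero => exact zero
  | of X =>
    obtain ⟨X, rfl⟩ := Quotient.exists_rep X
    exact of X
  | neg X h => exact neg _ h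
  | add x y hx hy => simpa using sub _ _ hx (neg _ hy)

lemma splitHom_ext {G : Type*} [AddCommGroup G] {f g : K0Split A →+ G}
    (h : ∀ X, f (splitClass X) = g (splitClass X)) : f = g := by
  refine DFunLike.ext _ _ fun x => ?_
  refine splitClass_induction (p := fun x => f x = g x) x (by simp) h fun x y hx hy => ?_
  rw [map_sub, map_sub, hx, hy]

end SplitClasses

section Shift

variable {C : Type u} [Category.{v} C] [Preadditive C] [HasShift C ℤ]

lemma hom_shift_shift_eq_zero {V X : C} {a b c : ℤ} (hc : a + b = c)
    (h : ∀ f : V ⟶ X⟦c⟧, f = 0) (f : V ⟶ X⟦a⟧⟦b⟧) : f = 0 := by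
  rw [← cancel_mono ((shiftFunctorAdd' C a b c hc).inv.app X), h (f ≫ _), zero_comp]

lemma hom_shift_eq_zero_of_iso {V X Y : C} (e : X ≅ Y) (n : ℤ)
    (h : ∀ f : V ⟶ X⟦n⟧, f = 0) (f : V ⟶ Y⟦n⟧) : f = 0 := by
  rw [← cancel_mono (e.inv⟦n⟧'), h (f ≫ e.inv⟦n⟧'), zero_comp]

end Shift

section Triangles

variable {C : Type u} [Category.{v} C] [Preadditive C] [HasZeroObject C] [HasShift C ℤ]
  [∀ n : ℤ, (shiftFunctor C n).Additive] [Pretriangulated C]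

/-- In a triangle with vanishing last morphism the middle term is the biproduct of the outer two. -/
lemma exists_bicone_of_mor₃_eq_zero {T : Triangle C} (hT : T ∈ distTriang C) (h : T.mor₃ = 0) :
    ∃ b : BinaryBicone T.obj₁ T.obj₃,
      b.fst ≫ b.inl + b.snd ≫ b.inr = 𝟙 b.pt ∧ b.pt = T.obj₂ := by
  have := T.epi₂ hT h
  have := isSplitEpi_of_epi T.mor₂
  obtain ⟨fst, hfst⟩ := T.coyoneda_exact₂ hT (𝟙 T.obj₂ - T.mor₂ ≫ section_ T.mor₂) (by simp)
  have total : fst ≫ T.mor₁ + T.mor₂ ≫ section_ T.mor₂ = 𝟙 T.obj₂ := by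
    rw [← hfst, sub_add_cancel]
  exact ⟨(binaryBiproductData _ hT h (section_ T.mor₂) (by simp) fst total).bicone, total, rfl⟩

/-- The inclusion `S ⊆ C` reflects the relation `[Y] = [X] + [Z]`. -/
lemma splitClass_of_mor₃_eq_zero {S : ObjectProperty C} {X Y Z : S.FullSubcategory}
    {f : X.obj ⟶ Y.obj} {g : Y.obj ⟶ Z.obj}
    (hT : Triangle.mk f g 0 ∈ distTriang C) :
    splitClass Y = splitClass X + splitClass Z := by
  obtain ⟨⟨P, fst, snd, inl, inr, h₁, h₂, h₃, h₄⟩, hb, rfl : P = Y.obj⟩ :=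
    exists_bicone_of_mor₃_eq_zero hT rfl
  let b : BinaryBicone X Z :=
    { pt := Y
      fst := ObjectProperty.homMk fst
      snd := ObjectProperty.homMk snd
      inl := ObjectProperty.homMk inl
      inr := ObjectProperty.homMk inr
      inl_fst := ObjectProperty.hom_ext _ h₁
      inl_snd := ObjectProperty.hom_ext _ h₂
      inr_fst := ObjectProperty.hom_ext _ h₃
      inr_snd := ObjectProperty.hom_ext _ h₄ }
  exact splitClass_bicone b (isBinaryBilimitOfTotal b (ObjectProperty.hom_ext _ hb))

section Exactness

variable {V X Y Z : C} {f : X ⟶ Y} {g : Y ⟶ Z} {h : Z ⟶ X⟦(1 : ℤ)⟧}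

lemma distTriang_comp₁₂ (hT : Triangle.mk f g h ∈ distTriang C) : f ≫ g = 0 :=
  comp_distTriang_mor_zero₁₂ _ hT

lemma distTriang_comp₂₃ (hT : Triangle.mk f g h ∈ distTriang C) : g ≫ h = 0 :=
  comp_distTriang_mor_zero₂₃ _ hT

lemma distTriang_desc₃ (hT : Triangle.mk f g h ∈ distTriang C) (p : Y ⟶ V) (hp : f ≫ p = 0) :
    ∃ q : Z ⟶ V, g ≫ q = p :=
  (Triangle.yoneda_exact₂ _ hT p hp).imp fun _ => Eq.symm

lemma distTriang_lift₁ (hT : Triangle.mk f g h ∈ distTriang C) (p : V ⟶ Y) (hp : p ≫ g = 0) :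
    ∃ q : V ⟶ X, q ≫ f = p :=
  (Triangle.coyoneda_exact₂ _ hT p hp).imp fun _ => Eq.symm

lemma distTriang_lift₂ (hT : Triangle.mk f g h ∈ distTriang C) (p : V ⟶ Z) (hp : p ≫ h = 0) :
    ∃ q : V ⟶ Y, q ≫ g = p :=
  (Triangle.coyoneda_exact₃ _ hT p hp).imp fun _ => Eq.symm

lemma distTriang_lift₃ (hT : Triangle.mk f g h ∈ distTriang C) (p : V ⟶ X⟦(1 : ℤ)⟧)
    (hp : p ≫ f⟦(1 : ℤ)⟧' = 0) : ∃ q : V ⟶ Z, q ≫ h = p :=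
  (Triangle.coyoneda_exact₁ _ hT p hp).imp fun _ => Eq.symm

end Exactness

variable {V : C}

lemma hom_shift_obj₂_eq_zero {T : Triangle C} (hT : T ∈ distTriang C) (n : ℤ)
    (h₁ : ∀ f : V ⟶ T.obj₁⟦n⟧, f = 0) (h₃ : ∀ f : V ⟶ T.obj₃⟦n⟧, f = 0)
    (f : V ⟶ T.obj₂⟦n⟧) : f = 0 := by
  obtain ⟨g, rfl⟩ := Triangle.coyoneda_exact₂ _ (Triangle.shift_distinguished T hT n) f (h₃ _)
  rw [h₁ g]
  exact zero_comp

lemma hom_shift_obj₃_eq_zero {T : Triangle C} (hT : T ∈ distTriang C) {n m : ℤ} (hm : 1 + n = m)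
    (h₂ : ∀ f : V ⟶ T.obj₂⟦n⟧, f = 0) (h₁ : ∀ f : V ⟶ T.obj₁⟦m⟧, f = 0)
    (f : V ⟶ T.obj₃⟦n⟧) : f = 0 :=
  hom_shift_obj₂_eq_zero (rot_of_distTriang _ hT) n h₂ (hom_shift_shift_eq_zero hm h₁) f

lemma hom_shift_obj₁_eq_zero {T : Triangle C} (hT : T ∈ distTriang C) {n m : ℤ} (hm : -1 + m = n)
    (h₃ : ∀ f : V ⟶ T.obj₃⟦n⟧, f = 0) (h₂ : ∀ f : V ⟶ T.obj₂⟦m⟧, f = 0)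
    (f : V ⟶ T.obj₁⟦m⟧) : f = 0 :=
  hom_shift_obj₂_eq_zero (inv_rot_of_distTriang _ hT) m (hom_shift_shift_eq_zero hm h₃) h₂ f

/-- If every morphism `V ⟶ T.obj₃` lifts to `T.obj₂`, then `Hom(V, ΣT.obj₁) ⟶ Hom(V, ΣT.obj₂)` is
injective. -/
lemma hom_shift_one_eq_zero {T : Triangle C} (hT : T ∈ distTriang C)
    (hl : ∀ f : V ⟶ T.obj₃, ∃ g : V ⟶ T.obj₂, g ≫ T.mor₂ = f)
    (h₂ : ∀ f : V ⟶ T.obj₂⟦(1 : ℤ)⟧, f = 0) (f : V ⟶ T.obj₁⟦(1 : ℤ)⟧) : f = 0 := by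
  obtain ⟨g, rfl⟩ := Triangle.coyoneda_exact₁ T hT f (h₂ _)
  obtain ⟨g, rfl⟩ := hl g
  rw [Category.assoc, comp_distTriang_mor_zero₂₃ _ hT, comp_zero]

variable [IsTriangulated C]

/-- The homotopy pullback of `Y ⟶ Z` along `U ⟶ Z`, in terms of the two induced triangles. -/
lemma exists_homotopy_pullback {X Y Z K U : C} {f : X ⟶ Y} {g : Y ⟶ Z} {h : Z ⟶ X⟦(1 : ℤ)⟧}
    (hT : Triangle.mk f g h ∈ distTriang C) {i : K ⟶ U} {p : U ⟶ Z} {q : Z ⟶ K⟦(1 : ℤ)⟧}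
    (hT' : Triangle.mk i p q ∈ distTriang C) :
    ∃ (E : C) (a : X ⟶ E) (b : E ⟶ U) (a' : K ⟶ E) (b' : E ⟶ Y),
      Triangle.mk a b (p ≫ h) ∈ distTriang C ∧ Triangle.mk a' b' (g ≫ q) ∈ distTriang C := by
  obtain ⟨E, a, b, hE⟩ := distinguished_cocone_triangle₂ (p ≫ h)
  exact ⟨E, a, b, _, _, hE, (Triangulated.someOctahedron' rfl hT'
    (v₂₃ := g) (w₂₃ := -f⟦(1 : ℤ)⟧') (rot_of_distTriang _ hT)
    (v₁₃ := b) (w₁₃ := -a⟦(1 : ℤ)⟧') (rot_of_distTriang _ hE)).mem⟩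

end Triangles

/-! ### Closure properties of cluster tilting subcategories -/

section ClusterTilting

variable {C : Type u} [Category.{v} C] [Preadditive C] [HasShift C ℤ]
  {S : ObjectProperty C} {d : ℕ}

lemma IsClusterTilting.hom_shift (hS : IsClusterTilting S d) {U V : C} (hU : S U) (hV : S V)
    {i : ℕ} (h₁ : 1 ≤ i) (h₂ : i < d) (f : U ⟶ V⟦(i : ℤ)⟧) : f = 0 :=
  (hS.mem_iff_right V).1 hV U hU i h₁ h₂ f

lemma IsClusterTilting.hom_shift_one (hS : IsClusterTilting S d) (hd : 2 ≤ d) {U V : C}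
    (hU : S U) (hV : S V) (f : U ⟶ V⟦(1 : ℤ)⟧) : f = 0 :=
  hS.hom_shift hU hV (i := 1) le_rfl hd f

lemma IsClusterTilting.prop_of_retract [∀ n : ℤ, (shiftFunctor C n).Additive]
    (hS : IsClusterTilting S d) {X U : C} (hU : S U)
    (i : X ⟶ U) (r : U ⟶ X) (h : i ≫ r = 𝟙 X) : S X := by
  refine (hS.mem_iff_right X).2 fun V hV n h₁ h₂ f => ?_
  rw [← Category.comp_id f, ← (shiftFunctor C (n : ℤ)).map_id, ← h, Functor.map_comp,
    ← Category.assoc, hS.hom_shift hV hU h₁ h₂ (f ≫ _), zero_comp]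

lemma IsClusterTilting.prop_of_iso [∀ n : ℤ, (shiftFunctor C n).Additive]
    (hS : IsClusterTilting S d) {X U : C} (e : U ≅ X) (hU : S U) : S X :=
  hS.prop_of_retract hU e.inv e.hom e.inv_hom_id

lemma IsClusterTilting.prop_of_isZero [∀ n : ℤ, (shiftFunctor C n).Additive]
    (hS : IsClusterTilting S d) {X : C} (hX : IsZero X) : S X :=
  (hS.mem_iff_right X).2 fun _ _ n _ _ _ => ((shiftFunctor C (n : ℤ)).map_isZero hX).eq_of_tgt _ _

variable [HasZeroObject C] [∀ n : ℤ, (shiftFunctor C n).Additive] [Pretriangulated C]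

lemma IsClusterTilting.prop_obj₂ (hS : IsClusterTilting S d) {T : Triangle C}
    (hT : T ∈ distTriang C) (h₁ : S T.obj₁) (h₃ : S T.obj₃) : S T.obj₂ :=
  (hS.mem_iff_right _).2 fun _ hV _ hi hi' =>
    hom_shift_obj₂_eq_zero hT _ (hS.hom_shift hV h₁ hi hi') (hS.hom_shift hV h₃ hi hi')

lemma IsClusterTilting.hom_shift_one_of_precover (hS : IsClusterTilting S d) (hd : 2 ≤ d)
    {T : Triangle C} (hT : T ∈ distTriang C) (hμ : IsPrecover S T.mor₂) (V : C) (hV : S V)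
    (f : V ⟶ T.obj₁⟦(1 : ℤ)⟧) : f = 0 :=
  hom_shift_one_eq_zero hT (hμ.2 V hV) (hS.hom_shift_one hd hV hμ.1) f

lemma isPrecover_of_comp_eq_zero {T : Triangle C} (hT : T ∈ distTriang C) (h₂ : S T.obj₂)
    (h : ∀ V : C, S V → ∀ f : V ⟶ T.obj₃, f ≫ T.mor₃ = 0) : IsPrecover S T.mor₂ := by
  refine ⟨h₂, fun V hV f => ?_⟩
  obtain ⟨g, hg⟩ := Triangle.coyoneda_exact₃ T hT f (h V hV f)
  exact ⟨g, hg.symm⟩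

end ClusterTilting

/-! ### Resolutions by objects of `S` -/

section Covers

variable {C : Type u} [Category.{v} C]

/-- The `S`-precovers, as a property of morphisms. -/
def precovers (S : ObjectProperty C) : MorphismProperty C := fun _ _ μ => IsPrecover S μ

/-- The `S`-covers, as a property of morphisms. -/
def covers (S : ObjectProperty C) : MorphismProperty C := fun _ _ μ => IsCover S μ

variable {S : ObjectProperty C}

lemma covers_le_precovers : covers S ≤ precovers S := fun _ _ _ h => h.1

lemma IsPrecover.comp_iso {U X Y : C} {μ : U ⟶ X} (h : IsPrecover S μ) (e : X ≅ Y) :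
    IsPrecover S (μ ≫ e.hom) := by
  refine ⟨h.1, fun V hV f => ?_⟩
  obtain ⟨g, hg⟩ := h.2 V hV (f ≫ e.inv)
  exact ⟨g, by rw [← Category.assoc, hg]; simp⟩

end Covers

section Resolutions

variable {C : Type u} [Category.{v} C] [Preadditive C] [HasZeroObject C] [HasShift C ℤ]
  [∀ n : ℤ, (shiftFunctor C n).Additive] [Pretriangulated C]

/-- `HasResolution P S n X x`: there are triangles `X_{l+1} ⟶ U_l ⟶ X_l ⟶ ΣX_{l+1}`, `0 ≤ l < n`,
with `X_0 = X`, all `U_l` in `S` and all `U_l ⟶ X_l` in `P`, such that `X_n ≅ U_n` lies in `S` and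
`x = ∑ (-1)ˡ [U_l]`. -/
inductive HasResolution (P : MorphismProperty C) (S : ObjectProperty C) :
    ℕ → C → K0Split S.FullSubcategory → Prop
  | zero (U : S.FullSubcategory) {X : C} (e : U.obj ≅ X) : HasResolution P S 0 X (splitClass U)
  | succ {n : ℕ} {X Y : C} {y : K0Split S.FullSubcategory} (U : S.FullSubcategory)
      {ι : Y ⟶ U.obj} {μ : U.obj ⟶ X} {δ : X ⟶ Y⟦(1 : ℤ)⟧}
      (hT : Triangle.mk ι μ δ ∈ distTriang C) (hμ : P μ) (hY : HasResolution P S n Y y) :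
      HasResolution P S (n + 1) X (splitClass U - y)

variable {P Q : MorphismProperty C} {S : ObjectProperty C} {d n : ℕ} {X Y Z : C}
  {x x' z : K0Split S.FullSubcategory}

lemma HasResolution.mono (hPQ : P ≤ Q) (h : HasResolution P S n X x) : HasResolution Q S n X x := by
  induction h with
  | zero U e => exact .zero U e
  | succ U hT hμ _ ih => exact .succ U hT (hPQ _ hμ) ih

lemma HasResolution.of_eq (h : HasResolution P S n X x) (hx : x = x') :
    HasResolution P S n X x' := hx ▸ h

lemma HasResolution.of_iso (hP : ∀ {U X Y : C} (μ : U ⟶ X) (e : X ≅ Y), P μ → P (μ ≫ e.hom))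
    (e : X ≅ Y) (h : HasResolution P S n X x) : HasResolution P S n Y x := by
  cases h with
  | zero U e' => exact .zero U (e' ≪≫ e)
  | @succ _ _ Y' _ U ι μ δ hT hμ hY =>
    exact .succ U (isomorphic_distinguished _ hT (Triangle.mk ι (μ ≫ e.hom) (e.inv ≫ δ))
      (Triangle.isoMk _ _ (Iso.refl _) (Iso.refl _) e.symm
        (by change ι ≫ 𝟙 _ = 𝟙 _ ≫ ι; simp)
        (by change (μ ≫ e.hom) ≫ e.inv = 𝟙 _ ≫ μ; simp)
        (by change (e.inv ≫ δ) ≫ (𝟙 Y')⟦(1 : ℤ)⟧' = e.inv ≫ δ; simp))) (hP _ e hμ) hY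

lemma HasResolution.precover_of_iso (e : X ≅ Y) (h : HasResolution (precovers S) S n X x) :
    HasResolution (precovers S) S n Y x :=
  h.of_iso (fun _ e h => IsPrecover.comp_iso h e) e

/-- An object of `S` is resolved by itself. -/
lemma HasResolution.self (hS : IsClusterTilting S d) (U : S.FullSubcategory) :
    HasResolution (precovers S) S n U.obj (splitClass U) := by
  induction n generalizing U with
  | zero => exact .zero U (Iso.refl _)
  | succ n ih =>
    have h₀ := hS.prop_of_isZero (isZero_zero C)
    refine (HasResolution.succ U (contractible_distinguished₁ U.obj)
      ⟨U.property, fun V _ f => ⟨f, Category.comp_id f⟩⟩ (ih ⟨_, h₀⟩)).of_eq ?_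
    rw [splitClass_eq_zero (X := (⟨_, h₀⟩ : S.FullSubcategory)), sub_zero]
    rw [IsZero.iff_id_eq_zero]
    exact ObjectProperty.hom_ext _ ((isZero_zero C).eq_of_src _ _)

/-- A split triangle, read in the other direction. -/
lemma exists_swap_of_split {f : X ⟶ Y} {g : Y ⟶ Z} (hT : Triangle.mk f g 0 ∈ distTriang C) :
    ∃ (s : Z ⟶ Y) (r : Y ⟶ X), Triangle.mk s r 0 ∈ distTriang C := by
  obtain ⟨e, -, -⟩ := exists_iso_binaryBiproduct_of_distTriang _ hT rfl
  let e' : Y ≅ Z ⊞ X := e ≪≫ biprod.braiding X Z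
  exact ⟨biprod.inl ≫ e'.inv, e'.hom ≫ biprod.snd,
    isomorphic_distinguished _ (binaryBiproductTriangle_distinguished Z X) _
      (Triangle.isoMk _ _ (Iso.refl _) e' (Iso.refl _)
        (by change (biprod.inl ≫ e'.inv) ≫ e'.hom = 𝟙 _ ≫ biprod.inl; simp)
        (by change (e'.hom ≫ biprod.snd) ≫ 𝟙 _ = e'.hom ≫ biprod.snd; simp)
        (by change (0 : X ⟶ _) ≫ _ = 𝟙 _ ≫ 0; simp))⟩

/-- Objects with `C(S, ΣⁱX) = 0` for `1 ≤ i ≤ j` have resolutions of length `d - 1 - j`: each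
precover raises the bound `j` by one, until the object lies in `S`. -/
theorem exists_hasResolution_of_hom_shift (hS : IsClusterTilting S d) (hP : P ≤ precovers S)
    (hP' : ∀ X : C, ∃ (U : C) (μ : U ⟶ X), P μ) {j : ℕ} (hn : n + j + 1 = d)
    (hX : ∀ V : C, S V → ∀ i : ℕ, 1 ≤ i → i ≤ j → ∀ f : V ⟶ X⟦(i : ℤ)⟧, f = 0) :
    ∃ x, HasResolution P S n X x := by
  induction n generalizing X j with
  | zero =>
    have h : S X := (hS.mem_iff_right X).2 fun V hV i h₁ h₂ => hX V hV i h₁ (by omega)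
    exact ⟨_, .zero ⟨X, h⟩ (Iso.refl _)⟩
  | succ n ih =>
    obtain ⟨U, μ, hμ⟩ := hP' X
    have hμ' : IsPrecover S μ := hP _ hμ
    obtain ⟨Y, ι, δ, hT⟩ := distinguished_cocone_triangle₁ μ
    obtain ⟨y, hy⟩ := ih (X := Y) (j := j + 1) (by omega) fun V hV i h₁ h₂ => by
      obtain _ | _ | i := i
      · omega
      · exact hS.hom_shift_one_of_precover (by omega) hT hμ' V hV
      · exact hom_shift_obj₁_eq_zero hT (n := ((i + 1 : ℕ) : ℤ)) (by push_cast; ring)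
          (hX V hV (i + 1) (by omega) (by omega))
          (hS.hom_shift hV hμ'.1 (by omega) (by omega))
    exact ⟨_, .succ ⟨U, hμ'.1⟩ hT hμ hy⟩

theorem exists_hasResolution (hS : IsClusterTilting S d) (hd : 1 ≤ d) (hP : P ≤ precovers S)
    (hP' : ∀ X : C, ∃ (U : C) (μ : U ⟶ X), P μ) (X : C) :
    ∃ x, HasResolution P S (d - 1) X x :=
  exists_hasResolution_of_hom_shift hS hP hP' (j := 0) (by omega) fun _ _ _ h₁ h₂ => by omega

/-- In a resolution of length less than `d` all morphisms `U_l ⟶ X_l` are automatically precovers: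
going back from `X_n` in `S`, each step costs one degree of the vanishing of `Hom(S, ΣⁱX)`. -/
lemma HasResolution.precovers_of_lt (hS : IsClusterTilting S d) (h : HasResolution P S n X x)
    (hn : n + 1 ≤ d) : HasResolution (precovers S) S n X x ∧
      ∀ V : C, S V → ∀ i : ℕ, 1 ≤ i → i + n < d → ∀ f : V ⟶ X⟦(i : ℤ)⟧, f = 0 := by
  induction h with
  | zero U e =>
    exact ⟨.zero U e, fun V hV i h₁ h₂ => hom_shift_eq_zero_of_iso e _
      (hS.hom_shift hV U.property h₁ h₂)⟩
  | @succ n X Y y U ι μ δ hT _ _ ih =>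
    obtain ⟨ih₁, ih₂⟩ := ih (by omega)
    refine ⟨.succ U hT (isPrecover_of_comp_eq_zero hT U.property fun V hV f =>
      ih₂ V hV 1 le_rfl (by omega) _) ih₁, fun V hV i h₁ h₂ => ?_⟩
    exact hom_shift_obj₃_eq_zero hT (m := ((i + 1 : ℕ) : ℤ)) (by push_cast; ring)
      (hS.hom_shift hV U.property h₁ (by omega)) (ih₂ V hV (i + 1) (by omega) (by omega))

variable [IsTriangulated C]

/-- A horseshoe lemma: resolutions by precovers are additive on the triangles whose last morphism
is invisible to `S`. -/
theorem HasResolution.add (hS : IsClusterTilting S d) (hn : n + 1 ≤ d)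
    (hx : HasResolution (precovers S) S n X x) (hz : HasResolution (precovers S) S n Z z)
    {f : X ⟶ Y} {g : Y ⟶ Z} {h : Z ⟶ X⟦(1 : ℤ)⟧} (hT : Triangle.mk f g h ∈ distTriang C)
    (hh : ∀ V : C, S V → ∀ p : V ⟶ Z, p ≫ h = 0) :
    HasResolution (precovers S) S n Y (x + z) := by
  induction n generalizing X Y Z x z with
  | zero =>
    obtain @⟨U, _, e⟩ := hx
    obtain @⟨U', _, e'⟩ := hz
    obtain rfl : h = 0 := by rw [← cancel_epi e'.hom, hh _ U'.property, comp_zero]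
    have hX := hS.prop_of_iso e U.property
    have hZ := hS.prop_of_iso e' U'.property
    have hY : S Y := hS.prop_obj₂ hT hX hZ
    refine (HasResolution.zero ⟨Y, hY⟩ (Iso.refl _)).of_eq ?_
    rw [splitClass_congr (S.isoMk e : U ≅ ⟨X, hX⟩), splitClass_congr (S.isoMk e' : U' ≅ ⟨Z, hZ⟩)]
    exact splitClass_of_mor₃_eq_zero (X := ⟨X, hX⟩) (Y := ⟨Y, hY⟩) (Z := ⟨Z, hZ⟩) hT
  | succ n ih =>
    obtain ⟨⟩ | @⟨_, _, X₁, x₁, U, ι, μ, δ, hU, hμ, hX₁⟩ := hx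
    obtain ⟨⟩ | @⟨_, _, Z₁, z₁, U', ι', μ', δ', hU', hμ', hZ₁⟩ := hz
    have hX₁v := hS.hom_shift_one_of_precover (by omega) hU hμ
    have hZ₁v := hS.hom_shift_one_of_precover (by omega) hU' hμ'
    -- `E` is the homotopy pullback of `Y ⟶ Z ⟵ U'`; it splits as `X ⊕ U'`.
    obtain ⟨E, a, b, a', b', hE, hE'⟩ := exists_homotopy_pullback hT hU'
    rw [hh _ U'.property] at hE
    obtain ⟨s, r, hsr⟩ := exists_swap_of_split hE
    -- `W` is `U ⊕ U'`, mapping to `E ≅ X ⊕ U'`.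
    obtain ⟨W, c, c', i, w, hW, hW'⟩ := exists_homotopy_pullback hsr hU
    rw [comp_zero] at hW
    have hWS : S W := hS.prop_obj₂ hW U'.property U.property
    obtain ⟨Y₁, j, k, hY₁⟩ := distinguished_cocone_triangle₁ (w ≫ b')
    have o := Triangulated.someOctahedron' rfl hW' hE' hY₁
    have hw : IsPrecover S (w ≫ b') := by
      refine ⟨hWS, fun V hV p => ?_⟩
      obtain ⟨q, hq⟩ := distTriang_lift₂ hE' p (hZ₁v V hV _)
      obtain ⟨t, ht⟩ := distTriang_lift₂ hW' q (hX₁v V hV _)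
      exact ⟨t, by rw [← Category.assoc, ht, hq]⟩
    refine (HasResolution.succ ⟨W, hWS⟩ hY₁ hw
      (ih (by omega) hX₁ hZ₁ o.mem fun V hV p => hX₁v V hV _)).of_eq ?_
    rw [splitClass_of_mor₃_eq_zero (X := U') (Y := ⟨W, hWS⟩) (Z := U) hW]
    abel

/-- Schanuel's lemma: two resolutions by precovers have the same alternating sum. -/
theorem HasResolution.unique (hS : IsClusterTilting S d) (hn : n + 1 ≤ d)
    (h : HasResolution (precovers S) S n X x) (h' : HasResolution (precovers S) S n X x') :
    x = x' := by
  induction n generalizing X x x' with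
  | zero =>
    obtain @⟨U, _, e⟩ := h
    obtain @⟨U', _, e'⟩ := h'
    exact splitClass_congr (S.isoMk (e ≪≫ e'.symm))
  | succ n ih =>
    obtain ⟨⟩ | @⟨_, _, Y, y, U, ι, μ, δ, hU, hμ, hY⟩ := h
    obtain ⟨⟩ | @⟨_, _, Y', y', U', ι', μ', δ', hU', hμ', hY'⟩ := h'
    have hv := hS.hom_shift_one_of_precover (by omega) hU hμ
    have hv' := hS.hom_shift_one_of_precover (by omega) hU' hμ'
    obtain ⟨E, _, _, _, _, hE, hE'⟩ := exists_homotopy_pullback hU hU'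
    have h₁ := HasResolution.add hS (by omega) hY (HasResolution.self hS U') hE
      fun V hV p => hv V hV _
    have h₂ := HasResolution.add hS (by omega) hY' (HasResolution.self hS U) hE'
      fun V hV p => hv' V hV _
    have h₃ := ih (by omega) h₁ h₂
    rw [sub_eq_sub_iff_add_eq_add, add_comm _ y, h₃, add_comm]

end Resolutions

/-! ### Towers of triangles -/

lemma sum_neg_one_pow_succ {G : Type*} [AddCommGroup G] {n : ℕ} (f : Fin (n + 2) → G) :
    ∑ i : Fin (n + 2), (-1 : ℤ) ^ (i : ℕ) • f i =
      f 0 - ∑ i : Fin (n + 1), (-1 : ℤ) ^ (i : ℕ) • f i.succ := by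
  rw [Fin.sum_univ_succ, sub_eq_add_neg, ← Finset.sum_neg_distrib]
  simp [pow_succ]

section Towers

variable {C : Type u} [Category.{v} C] [Preadditive C] [HasZeroObject C] [HasShift C ℤ]
  [∀ n : ℤ, (shiftFunctor C n).Additive] [Pretriangulated C]

/-- The data witnessing `HasResolution P S n X x`, in the format common to `IndexTower` (`P` being
the class of covers) and to `AngleTower` (`X` being the last term of the angle, and `P` being all
morphisms). -/
structure ResolutionTower (P : MorphismProperty C) (S : ObjectProperty C) (n : ℕ) (X : C) where
  U : Fin (n + 1) → S.FullSubcategory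
  Y : Fin (n + 1) → C
  iso : Y 0 ≅ X
  μ : ∀ l : Fin (n + 1), (U l).obj ⟶ Y l
  ι : ∀ l : Fin n, Y l.succ ⟶ (U l.castSucc).obj
  δ : ∀ l : Fin n, Y l.castSucc ⟶ (Y l.succ)⟦(1 : ℤ)⟧
  prop : ∀ l : Fin n, P (μ l.castSucc)
  isIso_μ : IsIso (μ (Fin.last n))
  distinguished : ∀ l : Fin n, Triangle.mk (ι l) (μ l.castSucc) (δ l) ∈ distTriang C

namespace ResolutionTower

variable {P : MorphismProperty C} {S : ObjectProperty C} {n : ℕ} {X Y : C}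

/-- The alternating sum of the classes of the terms of a tower. -/
def value (t : ResolutionTower P S n X) : K0Split S.FullSubcategory :=
  ∑ i : Fin (n + 1), (-1 : ℤ) ^ (i : ℕ) • splitClass (t.U i)

/-- Removing the first triangle of a tower. -/
def tail (t : ResolutionTower P S (n + 1) X) : ResolutionTower P S n (t.Y 1) where
  U l := t.U l.succ
  Y l := t.Y l.succ
  iso := Iso.refl _
  μ l := t.μ l.succ
  ι l := t.ι l.succ
  δ l := t.δ l.succ
  prop l := t.prop l.succ
  isIso_μ := t.isIso_μ
  distinguished l := t.distinguished l.succ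

lemma value_eq (t : ResolutionTower P S (n + 1) X) :
    t.value = splitClass (t.U 0) - t.tail.value :=
  sum_neg_one_pow_succ fun i => splitClass (t.U i)

/-- Adding a triangle at the beginning of a tower. -/
def cons (U : S.FullSubcategory) {ι : Y ⟶ U.obj} {μ : U.obj ⟶ X} {δ : X ⟶ Y⟦(1 : ℤ)⟧}
    (hT : Triangle.mk ι μ δ ∈ distTriang C) (hμ : P μ) (t : ResolutionTower P S n Y) :
    ResolutionTower P S (n + 1) X where
  U := Fin.cons U t.U
  Y := Fin.cons X t.Y
  iso := Iso.refl X
  μ := Fin.cases μ t.μ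
  ι := Fin.cases (t.iso.hom ≫ ι) t.ι
  δ := Fin.cases (δ ≫ t.iso.inv⟦(1 : ℤ)⟧') t.δ
  prop := Fin.cases hμ t.prop
  isIso_μ := by exact t.isIso_μ
  distinguished := Fin.cases
    (isomorphic_distinguished _ hT
      (Triangle.mk (t.iso.hom ≫ ι) μ (δ ≫ t.iso.inv⟦(1 : ℤ)⟧'))
      (Triangle.isoMk _ _ t.iso (Iso.refl _) (Iso.refl _)
        (by change (t.iso.hom ≫ ι) ≫ 𝟙 _ = t.iso.hom ≫ ι; simp)
        (by change μ ≫ 𝟙 _ = 𝟙 _ ≫ μ; simp)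
        (by
          change (δ ≫ t.iso.inv⟦(1 : ℤ)⟧') ≫ t.iso.hom⟦(1 : ℤ)⟧' = 𝟙 _ ≫ δ
          rw [Category.assoc, ← Functor.map_comp]
          simp)))
    t.distinguished

lemma hasResolution (t : ResolutionTower P S n X) : HasResolution P S n (t.Y 0) t.value := by
  induction n generalizing X with
  | zero =>
    have : IsIso (t.μ 0) := t.isIso_μ
    exact (HasResolution.zero (t.U 0) (asIso (t.μ 0))).of_eq (by simp [value])
  | succ n ih =>
    exact (HasResolution.succ (t.U 0) (t.distinguished 0) (t.prop 0) (ih t.tail)).of_eq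
      t.value_eq.symm

end ResolutionTower

variable {P : MorphismProperty C} {S : ObjectProperty C} {n d : ℕ} {X : C}
  {x : K0Split S.FullSubcategory}

lemma HasResolution.exists_tower (h : HasResolution P S n X x) :
    ∃ t : ResolutionTower P S n X, t.value = x := by
  induction h with
  | zero U e =>
    exact ⟨⟨fun _ => U, fun _ => U.obj, e, fun _ => 𝟙 _, Fin.elim0, Fin.elim0, fun l => l.elim0,
      inferInstance, fun l => l.elim0⟩, by simp [ResolutionTower.value]⟩
  | @succ n X Y y U ι μ δ hT hμ _ ih =>
    obtain ⟨t, rfl⟩ := ih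
    exact ⟨t.cons U hT hμ, ResolutionTower.value_eq _⟩

lemma HasResolution.of_isIndex (h : IsIndex S d X x) :
    HasResolution (precovers S) S (d - 1) X x := by
  obtain ⟨n, rfl, t, rfl⟩ := h
  let t' : ResolutionTower (covers S) S n X :=
    ⟨t.U, t.Y, t.iso, t.μ, t.ι, t.δ, t.isCover, t.isIso_μ, t.distinguished⟩
  exact (t'.hasResolution.mono covers_le_precovers).precover_of_iso t.iso

lemma HasResolution.isIndex (h : HasResolution (covers S) S n X x) : IsIndex S (n + 1) X x := by
  obtain ⟨t, rfl⟩ := h.exists_tower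
  exact ⟨n, rfl, ⟨t.U, t.Y, t.iso, t.μ, t.ι, t.δ, t.prop, t.isIso_μ, t.distinguished⟩, rfl⟩

/-- The alternating sum of an angle is `[S_0] - x`, for a resolution of `S_0` with alternating
sum `x`. -/
lemma exists_hasResolution_of_isAngle {s : AngleSequence S d} (hs : IsAngle s) :
    ∃ x, HasResolution ⊤ S d (s.obj 0).obj x ∧
      ∑ i : Fin (d + 2), (-1 : ℤ) ^ (i : ℕ) • splitClass (s.obj i) = splitClass (s.obj 0) - x := by
  obtain ⟨t⟩ := hs
  have := t.isIso_inj
  let e := asIso (t.inj 0)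
  let t' : ResolutionTower ⊤ S d (s.obj 0).obj :=
    ⟨fun l => s.obj l.succ, t.Y, e, t.proj, fun l => t.inj l.succ, t.δ,
      fun _ => trivial, t.isIso_proj, t.distinguished⟩
  exact ⟨t'.value, t'.hasResolution.of_iso (fun _ _ _ => trivial) t'.iso,
    sum_neg_one_pow_succ fun i => splitClass (s.obj i)⟩

lemma HasResolution.exists_isAngle {Q : S.FullSubcategory} (h : HasResolution ⊤ S d Q.obj x) :
    ∃ s : AngleSequence S d, IsAngle s ∧
      ∑ i : Fin (d + 2), (-1 : ℤ) ^ (i : ℕ) • splitClass (s.obj i) = splitClass Q - x := by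
  obtain ⟨t, rfl⟩ := h.exists_tower
  have := t.isIso_μ
  let e := asIso (t.μ (Fin.last d))
  let inj : ∀ l : Fin (d + 1), t.Y l ⟶
      ((Fin.cons Q t.U : Fin (d + 2) → S.FullSubcategory) l.castSucc).obj :=
    Fin.cases t.iso.hom t.ι
  let s : AngleSequence S d :=
    { obj := Fin.cons Q t.U
      map := fun l => t.μ l ≫ inj l
      conn := t.iso.inv ≫ lowerEdge t.Y t.δ d (Nat.lt_succ_self d) ≫
        (shiftFunctor C (d : ℤ)).map e.inv }
  refine ⟨s, ⟨⟨t.Y, inj, t.μ, t.δ, inferInstanceAs (IsIso t.iso.hom), t.isIso_μ, t.distinguished,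
    fun _ => rfl, ?_⟩⟩, sum_neg_one_pow_succ fun i => splitClass (s.obj i)⟩
  change t.iso.hom ≫ (t.iso.inv ≫ lowerEdge t.Y t.δ d _ ≫ (shiftFunctor C (d : ℤ)).map e.inv) ≫
    (shiftFunctor C (d : ℤ)).map e.hom = _
  rw [Category.assoc, Category.assoc, ← Functor.map_comp]
  simp

/-- The subgroup `R` is generated by the elements `[Q] - x`, for `Q` in `S` and the alternating sums
`x` of resolutions of `Q` of length `d`. -/
lemma angleRelations_eq_closure : angleRelations S d = AddSubgroup.closure
    {z | ∃ (Q : S.FullSubcategory) (x : K0Split S.FullSubcategory),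
      HasResolution ⊤ S d Q.obj x ∧ z = splitClass Q - x} := by
  refine congrArg AddSubgroup.closure (Set.ext fun z => ⟨?_, ?_⟩)
  · rintro ⟨s, hs, rfl⟩
    obtain ⟨x, hx, h⟩ := exists_hasResolution_of_isAngle hs
    exact ⟨_, x, hx, h⟩
  · rintro ⟨Q, x, hx, rfl⟩
    obtain ⟨s, hs, h⟩ := hx.exists_isAngle
    exact ⟨s, hs, h.symm⟩

/-- A triangle `T ⟶ P ⟶ Q ⟶ ΣT` with `P`, `Q` in `S`, together with a resolution of `T`, is a
`(d+2)`-angle. -/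
lemma HasResolution.mem_angleRelations (hd : 1 ≤ d) {T : C} {Q R : S.FullSubcategory}
    {f : T ⟶ R.obj} {g : R.obj ⟶ Q.obj} {h : Q.obj ⟶ T⟦(1 : ℤ)⟧}
    (hT : Triangle.mk f g h ∈ distTriang C) (hx : HasResolution P S (d - 1) T x) :
    splitClass Q - splitClass R + x ∈ angleRelations S d := by
  rw [angleRelations_eq_closure, sub_add]
  refine AddSubgroup.subset_closure ⟨Q, splitClass R - x, ?_, rfl⟩
  obtain ⟨d, rfl⟩ := Nat.exists_eq_add_of_le' hd
  exact .succ R hT trivial (hx.mono le_top)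

end Towers

/-! ### Existence of covers -/

section Covers

/-- In a finite dimensional algebra, the powers of an element eventually divide each other. -/
lemma exists_pow_succ_mul_eq (k : Type w) [Field k] {A : Type v} [Ring A] [Algebra k A]
    [Module.Finite k A] (a : A) : ∃ (n : ℕ) (y : A), Commute a y ∧ a ^ (n + 1) * y = a ^ n := by
  let B := Algebra.adjoin k {a}
  have : IsMulCommutative B := Algebra.isMulCommutative_adjoin k (by simp)
  have : Module.Finite k B := Module.Finite.of_injective B.val.toLinearMap Subtype.val_injective
  have : IsArtinianRing B := IsArtinianRing.of_finite k B
  let b : B := ⟨a, Algebra.subset_adjoin rfl⟩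
  obtain ⟨n, y, hy⟩ := IsArtinian.exists_pow_succ_smul_dvd b (1 : B)
  exact ⟨n, y, congrArg Subtype.val (mul_comm b y), by simpa using congrArg Subtype.val hy⟩

/-- Fitting's lemma: an element `a` of a finite dimensional algebra has an idempotent `e` with
`aⁿ e = aⁿ` for some `n`, such that `a` is a unit if `e = 1`. -/
lemma exists_fitting_idempotent (k : Type w) [Field k] {A : Type v} [Ring A] [Algebra k A]
    [Module.Finite k A] (a : A) :
    ∃ (n : ℕ) (e : A), IsIdempotentElem e ∧ a ^ n * e = a ^ n ∧ (e = 1 → IsUnit a) := by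
  obtain ⟨n, y, hc, hy⟩ := exists_pow_succ_mul_eq k a
  have h : ∀ m, a ^ (n + m) * y ^ m = a ^ n := by
    intro m
    induction m with
    | zero => simp
    | succ m ih =>
      calc a ^ (n + (m + 1)) * y ^ (m + 1)
          = a ^ m * (a ^ (n + 1) * y) * y ^ m := by
            rw [pow_succ', ← mul_assoc, ← mul_assoc, ← pow_add]; congr 3; omega
        _ = a ^ n := by rw [hy, ← pow_add, add_comm m n, ih]
  have he : a ^ n * (a ^ n * y ^ n) = a ^ n := by rw [← mul_assoc, ← pow_add, h]
  have hyn : Commute (y ^ n) (a ^ n * y ^ n) :=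
    (hc.pow_pow n n).symm.mul_right (Commute.refl _)
  refine ⟨n, a ^ n * y ^ n, ?_, he, fun h₁ => ?_⟩
  · rw [IsIdempotentElem, mul_assoc, hyn.eq, ← mul_assoc, he]
  · -- `aⁿ` is invertible, so that it can be cancelled in `aⁿ (a y) = aⁿ`.
    have h₂ : y ^ n * a ^ n = 1 := by rw [← (hc.pow_pow n n).eq, h₁]
    have h₃ : a * y = 1 := by
      calc a * y = y ^ n * (a ^ (n + 1) * y) := by
            rw [pow_succ, mul_assoc (a ^ n), ← mul_assoc, h₂, one_mul]
        _ = 1 := by rw [hy, h₂]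
    exact ⟨⟨a, y, h₃, hc.eq ▸ h₃⟩, rfl⟩

/-- A precover of `X` whose source has an endomorphism algebra of minimal dimension is a cover:
by Fitting's lemma, an endomorphism over `X` that is not invertible would cut off a summand. -/
theorem exists_isCover (k : Type w) [Field k] {C : Type u} [Category.{v} C] [Preadditive C]
    [Linear k C] [∀ X Y : C, Module.Finite k (X ⟶ Y)] [IsIdempotentComplete C]
    {S : ObjectProperty C}
    (hS : ∀ {X U : C}, S U → ∀ (i : X ⟶ U) (r : U ⟶ X), i ≫ r = 𝟙 X → S X)
    {X : C} (hX : ∃ (U : C) (μ : U ⟶ X), IsPrecover S μ) :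
    ∃ (U : C) (μ : U ⟶ X), IsCover S μ := by
  classical
  have hn : ∃ n, ∃ (U : C) (μ : U ⟶ X), IsPrecover S μ ∧ Module.finrank k (U ⟶ U) = n := by
    obtain ⟨U, μ, hμ⟩ := hX
    exact ⟨_, U, μ, hμ, rfl⟩
  obtain ⟨U, μ, hμ, hU⟩ := Nat.find_spec hn
  refine ⟨U, μ, hμ, fun φ hφ => ?_⟩
  have : Module.Finite k (End U) := inferInstanceAs (Module.Finite k (U ⟶ U))
  obtain ⟨n, e, hee, hne, hunit⟩ := exists_fitting_idempotent k (A := End U) φ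
  have hpow : ∀ m : ℕ, (show U ⟶ U from (show End U from φ) ^ m) ≫ μ = μ := by
    intro m
    induction m with
    | zero => exact Category.id_comp μ
    | succ m ih =>
      rw [pow_succ]
      change (φ ≫ _) ≫ μ = μ
      rw [Category.assoc, ih, hφ]
  have heμ : (show U ⟶ U from e) ≫ μ = μ := by
    conv_lhs => rw [← hpow n]
    rw [← Category.assoc]
    exact (congrArg (fun ψ : U ⟶ U => ψ ≫ μ) hne).trans (hpow n)
  obtain ⟨U', i, r, hir, hri⟩ := IsIdempotentComplete.idempotents_split U (e : U ⟶ U) hee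
  have hμ' : IsPrecover S (i ≫ μ) := by
    refine ⟨hS hμ.1 i r hir, fun V hV g => ?_⟩
    obtain ⟨h, rfl⟩ := hμ.2 V hV g
    refine ⟨h ≫ r, ?_⟩
    rw [Category.assoc, ← Category.assoc r, hri, heμ]
  let L : (U' ⟶ U') →ₗ[k] (U ⟶ U) := Linear.rightComp k U i ∘ₗ Linear.leftComp k U' r
  have hL : ∀ x, L x = (r ≫ x) ≫ i := fun _ => rfl
  have hinj : Function.Injective L := by
    intro x y hxy
    have h := congrArg (fun z => i ≫ z ≫ r) hxy
    simpa [hL, hir, reassoc_of% hir] using h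
  have hrank : Module.finrank k (U' ⟶ U') = Module.finrank k (U ⟶ U) :=
    le_antisymm (LinearMap.finrank_le_finrank_of_injective hinj)
      (hU.trans_le (Nat.find_min' hn ⟨U', _, hμ', rfl⟩))
  obtain ⟨x, hx⟩ := (LinearMap.injective_iff_surjective_of_finrank_eq_finrank hrank).1 hinj (𝟙 U)
  have he : (show U ⟶ U from e) = 𝟙 U := by
    rw [← Category.comp_id (show U ⟶ U from e), ← hx, hL]
    change e ≫ _ = _
    rw [← hri]
    simp [reassoc_of% hir]
  exact (isUnit_iff_isIso _).1 (hunit he)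

end Covers

/-! ### The index -/

section Index

variable {C : Type u} [Category.{v} C] [Preadditive C] [HasZeroObject C] [HasShift C ℤ]
  [∀ n : ℤ, (shiftFunctor C n).Additive] [Pretriangulated C]
  {S : ObjectProperty C} {d : ℕ}

/-- The index of `X`: the alternating sum of any resolution of `X` of length `d - 1` by
precovers. -/
noncomputable def index (hS : IsClusterTilting S d) (hd : 1 ≤ d) (X : C) :
    K0Split S.FullSubcategory :=
  (exists_hasResolution hS hd le_rfl hS.functoriallyFinite.1 X).choose

variable {hS : IsClusterTilting S d} {hd : 1 ≤ d}

lemma hasResolution_index (X : C) :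
    HasResolution (precovers S) S (d - 1) X (index hS hd X) :=
  (exists_hasResolution hS hd le_rfl hS.functoriallyFinite.1 X).choose_spec

variable [IsTriangulated C]

lemma index_eq {X : C} {x : K0Split S.FullSubcategory}
    (h : HasResolution (precovers S) S (d - 1) X x) : index hS hd X = x :=
  HasResolution.unique hS (by omega) (hasResolution_index X) h

lemma index_congr {X Y : C} (e : X ≅ Y) : index hS hd X = index hS hd Y :=
  (index_eq ((hasResolution_index X).precover_of_iso e)).symm

lemma index_of_mem (U : S.FullSubcategory) : index hS hd U.obj = splitClass U :=
  index_eq (HasResolution.self hS U)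

lemma index_triangle {X Y Z : C} {f : X ⟶ Y} {g : Y ⟶ Z} {h : Z ⟶ X⟦(1 : ℤ)⟧}
    (hT : Triangle.mk f g h ∈ distTriang C) (hh : ∀ V : C, S V → ∀ p : V ⟶ Z, p ≫ h = 0) :
    index hS hd Y = index hS hd X + index hS hd Z :=
  index_eq (HasResolution.add hS (by omega) (hasResolution_index X) (hasResolution_index Z) hT hh)

lemma index_of_precover {X Y : C} {U : S.FullSubcategory} {f : Y ⟶ U.obj} {g : U.obj ⟶ X}
    {h : X ⟶ Y⟦(1 : ℤ)⟧} (hT : Triangle.mk f g h ∈ distTriang C) (hg : IsPrecover S g) :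
    splitClass U = index hS hd Y + index hS hd X := by
  rw [← index_of_mem (hS := hS) (hd := hd) U]
  refine index_triangle hT fun V hV p => ?_
  obtain ⟨q, rfl⟩ := hg.2 V hV p
  rw [Category.assoc, distTriang_comp₂₃ hT, comp_zero]

theorem isIndexFunction_index (k : Type w) [Field k] [Linear k C]
    [∀ X Y : C, Module.Finite k (X ⟶ Y)] [IsIdempotentComplete C] :
    IsIndexFunction S d (index hS hd) := by
  refine fun X x => ⟨fun h => (index_eq (.of_isIndex h)).symm, ?_⟩
  rintro rfl
  obtain ⟨x, hx⟩ := exists_hasResolution hS hd covers_le_precovers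
    (fun X => exists_isCover k hS.prop_of_retract (hS.functoriallyFinite.1 X)) X
  rw [index_eq (hx.mono covers_le_precovers)]
  obtain ⟨d, rfl⟩ := Nat.exists_eq_add_of_le' hd
  exact hx.isIndex

end Index

/-! ### The isomorphism `K₀(S) ≅ K₀(C)` -/

section GrothendieckGroups

variable {C : Type u} [Category.{v} C] [Preadditive C] [HasZeroObject C] [HasShift C ℤ]
  [∀ n : ℤ, (shiftFunctor C n).Additive] [Pretriangulated C]
  {S : ObjectProperty C} {d n : ℕ}

lemma distTriang_of_bicone {X Y : S.FullSubcategory} (b : BinaryBicone X Y) (hb : b.IsBilimit) :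
    Triangle.mk b.inl.hom b.snd.hom (0 : Y.obj ⟶ X.obj⟦(1 : ℤ)⟧) ∈ distTriang C := by
  have h₁ : b.inl.hom ≫ b.fst.hom = 𝟙 X.obj := congrArg InducedCategory.Hom.hom b.inl_fst
  have h₂ : b.inl.hom ≫ b.snd.hom = 0 := congrArg InducedCategory.Hom.hom b.inl_snd
  have h₃ : b.inr.hom ≫ b.fst.hom = 0 := congrArg InducedCategory.Hom.hom b.inr_fst
  have h₄ : b.inr.hom ≫ b.snd.hom = 𝟙 Y.obj := congrArg InducedCategory.Hom.hom b.inr_snd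
  have h₅ : b.fst.hom ≫ b.inl.hom + b.snd.hom ≫ b.inr.hom = 𝟙 b.pt.obj :=
    congrArg InducedCategory.Hom.hom (IsBilimit.binary_total hb)
  let e : b.pt.obj ≅ X.obj ⊞ Y.obj :=
    { hom := biprod.lift b.fst.hom b.snd.hom
      inv := biprod.desc b.inl.hom b.inr.hom
      hom_inv_id := by rw [biprod.lift_desc, h₅]
      inv_hom_id := by ext <;> simp [h₁, h₂, h₃, h₄] }
  exact isomorphic_distinguished _ (binaryBiproductTriangle_distinguished X.obj Y.obj) _
    (Triangle.isoMk _ _ (Iso.refl _) e (Iso.refl _)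
      (by
        change b.inl.hom ≫ biprod.lift b.fst.hom b.snd.hom = 𝟙 _ ≫ biprod.inl
        ext <;> simp [h₁, h₂])
      (by
        change b.snd.hom ≫ 𝟙 _ = biprod.lift b.fst.hom b.snd.hom ≫ biprod.snd
        simp)
      (by change (0 : Y.obj ⟶ _) ≫ _ = 𝟙 _ ≫ 0; simp))

lemma triangulatedClass_triangle {X Y Z : C} {f : X ⟶ Y} {g : Y ⟶ Z} {h : Z ⟶ X⟦(1 : ℤ)⟧}
    (hT : Triangle.mk f g h ∈ distTriang C) :
    triangulatedClass Y = triangulatedClass X + triangulatedClass Z := by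
  have h : splitClass X - splitClass Y + splitClass Z ∈ triangleRelations C :=
    AddSubgroup.subset_closure ⟨_, hT, rfl⟩
  have h' := (QuotientAddGroup.eq_zero_iff _).2 h
  rw [QuotientAddGroup.mk_add, QuotientAddGroup.mk_sub, sub_add_eq_add_sub, sub_eq_zero] at h'
  exact h'.symm

variable (S) in
/-- The homomorphism `K₀ˢᵖ(S) ⟶ K₀(C)` induced by the inclusion. -/
noncomputable def splitToTriangulated : K0Split S.FullSubcategory →+ K0Triangulated C :=
  splitLift (fun X => triangulatedClass X.obj)
    (fun e => congrArg QuotientAddGroup.mk (splitClass_congr (S.ι.mapIso e)))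
    (fun b hb => triangulatedClass_triangle (distTriang_of_bicone b hb))

@[simp]
lemma splitToTriangulated_splitClass (U : S.FullSubcategory) :
    splitToTriangulated S (splitClass U) = triangulatedClass U.obj :=
  FreeAbelianGroup.lift_apply_of _ _

lemma HasResolution.splitToTriangulated_eq {P : MorphismProperty C} {X : C}
    {x : K0Split S.FullSubcategory} (h : HasResolution P S n X x) :
    splitToTriangulated S x = triangulatedClass X := by
  induction h with
  | zero U e =>
    rw [splitToTriangulated_splitClass]
    exact congrArg QuotientAddGroup.mk (splitClass_congr e)
  | succ U hT _ _ ih =>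
    rw [map_sub, ih, splitToTriangulated_splitClass, triangulatedClass_triangle hT,
      add_sub_cancel_left]

lemma angleRelations_le_ker : angleRelations S d ≤ (splitToTriangulated S).ker := by
  rw [angleRelations_eq_closure, AddSubgroup.closure_le]
  rintro _ ⟨Q, x, hx, rfl⟩
  change splitToTriangulated S _ = 0
  rw [map_sub, hx.splitToTriangulated_eq, splitToTriangulated_splitClass, sub_self]

variable [IsTriangulated C] {hS : IsClusterTilting S d} {hd : 1 ≤ d}

/-- The index is additive on all triangles modulo the relations of the angles. By passing to
homotopy pullbacks along precovers, which changes the index in a controlled way, the last two terms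
of the triangle are moved into `S`. -/
theorem index_mem_angleRelations {X Y Z : C} {f : X ⟶ Y} {g : Y ⟶ Z} {h : Z ⟶ X⟦(1 : ℤ)⟧}
    (hT : Triangle.mk f g h ∈ distTriang C) :
    index hS hd X - index hS hd Y + index hS hd Z ∈ angleRelations S d := by
  obtain rfl | hd' := hd.eq_or_lt
  · have hmem : ∀ X : C, S X := fun X => (hS.mem_iff_right X).2 fun _ _ _ _ _ => by omega
    have h₁ := HasResolution.mem_angleRelations (R := ⟨Y, hmem Y⟩) (Q := ⟨Z, hmem Z⟩) hd hT
      (hasResolution_index (hS := hS) (hd := hd) X)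
    rw [← index_of_mem (hS := hS) (hd := hd), ← index_of_mem (hS := hS) (hd := hd)] at h₁
    convert h₁ using 1
    abel
  · obtain ⟨Q, q, hq⟩ := hS.functoriallyFinite.1 Z
    obtain ⟨Z₁, _, _, hZ₁⟩ := distinguished_cocone_triangle₁ q
    have hZ₁v := hS.hom_shift_one_of_precover hd' hZ₁ hq
    obtain ⟨E, _, b, _, _, hE, hE'⟩ := exists_homotopy_pullback hT hZ₁
    obtain ⟨P, p, hp⟩ := hS.functoriallyFinite.1 E
    obtain ⟨E₁, _, _, hE₁⟩ := distinguished_cocone_triangle₁ p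
    have hE₁v := hS.hom_shift_one_of_precover hd' hE₁ hp
    obtain ⟨T, _, _, hTT⟩ := distinguished_cocone_triangle₁ (p ≫ b)
    have o := (Triangulated.someOctahedron' rfl hE₁ hE hTT).mem
    -- There are triangles `Z₁ ⟶ Q ⟶ Z`, `Z₁ ⟶ E ⟶ Y`, `E₁ ⟶ P ⟶ E`, `E₁ ⟶ T ⟶ X`, on which the
    -- index is additive, and a triangle `T ⟶ P ⟶ Q`, which comes from an angle.
    have h₁ := index_of_precover (hS := hS) (hd := hd) (U := ⟨Q, hq.1⟩) hZ₁ hq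
    have h₂ := index_triangle (hS := hS) (hd := hd) hE' fun V hV _ => hZ₁v V hV _
    have h₃ := index_of_precover (hS := hS) (hd := hd) (U := ⟨P, hp.1⟩) hE₁ hp
    have h₄ := index_triangle (hS := hS) (hd := hd) o fun V hV _ => hE₁v V hV _
    have h₅ := HasResolution.mem_angleRelations (R := ⟨P, hp.1⟩) (Q := ⟨Q, hq.1⟩) hd hTT
      (hasResolution_index (hS := hS) (hd := hd) T)
    rw [h₁, h₃, h₄, h₂] at h₅
    convert h₅ using 1
    abel

variable (hS hd) in
/-- The index modulo the relations of the angles, as a homomorphism on `K₀ˢᵖ(C)`. -/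
noncomputable def splitIndexClass : K0Split C →+ K0Angulated S d :=
  splitLift (fun X => QuotientAddGroup.mk (index hS hd X))
    (fun e => congrArg QuotientAddGroup.mk (index_congr e))
    (fun {X Y} b hb => by
      have hT : Triangle.mk b.inl b.snd (0 : Y ⟶ X⟦(1 : ℤ)⟧) ∈ distTriang C :=
        isomorphic_distinguished _ (binaryBiproductTriangle_distinguished X Y) _
          (Triangle.isoMk _ _ (Iso.refl _) (biprod.uniqueUpToIso _ _ hb) (Iso.refl _)
            (by change b.inl ≫ biprod.lift b.fst b.snd = 𝟙 _ ≫ biprod.inl; ext <;> simp)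
            (by change b.snd ≫ 𝟙 _ = biprod.lift b.fst b.snd ≫ biprod.snd; simp)
            (by change (0 : Y ⟶ _) ≫ _ = 𝟙 _ ≫ 0; simp))
      exact congrArg QuotientAddGroup.mk
        (index_triangle hT fun _ _ _ => comp_zero))

lemma splitIndexClass_splitClass (X : C) :
    splitIndexClass hS hd (splitClass X) = QuotientAddGroup.mk (index hS hd X) :=
  FreeAbelianGroup.lift_apply_of _ _

lemma triangleRelations_le_ker : triangleRelations C ≤ (splitIndexClass hS hd).ker := by
  rw [triangleRelations, AddSubgroup.closure_le]
  rintro _ ⟨T, hT, rfl⟩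
  change splitIndexClass hS hd _ = 0
  rw [map_add, map_sub, splitIndexClass_splitClass, splitIndexClass_splitClass,
    splitIndexClass_splitClass]
  exact (QuotientAddGroup.eq_zero_iff _).2 (index_mem_angleRelations hT)

variable (hS hd) in
/-- The isomorphism `K₀(S) ≅ K₀(C)` induced by the inclusion; its inverse is given by the index. -/
noncomputable def angulatedEquivTriangulated : K0Angulated S d ≃+ K0Triangulated C :=
  AddMonoidHom.toAddEquiv
    (QuotientAddGroup.lift _ (splitToTriangulated S) angleRelations_le_ker)
    (QuotientAddGroup.lift _ (splitIndexClass hS hd) triangleRelations_le_ker)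
    (by
      refine QuotientAddGroup.addMonoidHom_ext _ (splitHom_ext fun U => ?_)
      change QuotientAddGroup.lift _ (splitIndexClass hS hd) triangleRelations_le_ker
        (splitToTriangulated S (splitClass U)) = angulatedClass d U
      rw [splitToTriangulated_splitClass]
      change splitIndexClass hS hd (splitClass U.obj) = _
      rw [splitIndexClass_splitClass, index_of_mem]
      rfl)
    (by
      refine QuotientAddGroup.addMonoidHom_ext _ (splitHom_ext fun X => ?_)
      change QuotientAddGroup.lift _ (splitToTriangulated S) angleRelations_le_ker
        (splitIndexClass hS hd (splitClass X)) = triangulatedClass X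
      rw [splitIndexClass_splitClass]
      exact (hasResolution_index X).splitToTriangulated_eq)

lemma angulatedEquivTriangulated_angulatedClass (U : S.FullSubcategory) :
    angulatedEquivTriangulated hS hd (angulatedClass d U) = triangulatedClass U.obj :=
  splitToTriangulated_splitClass U

end GrothendieckGroups

/-! ### The sum `index (Σ⁻¹N) + index N` -/

section IndexSum

variable {C : Type u} [Category.{v} C] [Preadditive C] [HasZeroObject C] [HasShift C ℤ]
  [∀ n : ℤ, (shiftFunctor C n).Additive] [Pretriangulated C]
  {S : ObjectProperty C} {d : ℕ} {hS : IsClusterTilting S d} {hd : 1 ≤ d}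

variable (hS hd) in
/-- The value `index (Σ⁻¹N) + index N` of `θ` on `[F_S N]`. -/
noncomputable def indexSum (N : C) : K0Split S.FullSubcategory :=
  index hS hd (N⟦(-1 : ℤ)⟧) + index hS hd N

/-- The objects of `S * ΣS` are the cones of the morphisms of `S`. -/
lemma exists_triangle_of_extensionProduct (hS : IsClusterTilting S d) {N : C}
    (hN : S.extensionProduct (S.map (shiftFunctor C (1 : ℤ))) N) :
    ∃ (P Q : S.FullSubcategory) (f : P.obj ⟶ Q.obj) (g : Q.obj ⟶ N) (h : N ⟶ P.obj⟦(1 : ℤ)⟧),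
      Triangle.mk f g h ∈ distTriang C := by
  obtain ⟨A, B', g, g', g'', hT, hA, B, hB, ⟨e⟩⟩ := hN
  obtain ⟨K, f, h, hK⟩ := distinguished_cocone_triangle₁ g
  let e' := Triangle.π₃.mapIso
    (isoTriangleOfIso₁₂ _ _ hT (rot_of_distTriang _ hK) (Iso.refl A) (Iso.refl N)
      (by change g ≫ 𝟙 N = 𝟙 A ≫ g; simp))
  have hKS : S K := hS.prop_of_iso ((shiftFunctor C (1 : ℤ)).preimageIso (e ≪≫ e')) hB
  exact ⟨⟨K, hKS⟩, ⟨A, hA⟩, f, g, h, hK⟩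

lemma extensionProduct_of_triangle {N : C} {P Q : S.FullSubcategory} {f : P.obj ⟶ Q.obj}
    {g : Q.obj ⟶ N} {h : N ⟶ P.obj⟦(1 : ℤ)⟧} (hT : Triangle.mk f g h ∈ distTriang C) :
    S.extensionProduct (S.map (shiftFunctor C (1 : ℤ))) N :=
  ⟨_, _, _, _, _, rot_of_distTriang _ hT, Q.property, S.prop_map_obj _ P.property⟩

lemma exists_inv_rotate {X Y Z : C} {f : X ⟶ Y} {g : Y ⟶ Z} {h : Z ⟶ X⟦(1 : ℤ)⟧}
    (hT : Triangle.mk f g h ∈ distTriang C) :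
    ∃ (f' : Z⟦(-1 : ℤ)⟧ ⟶ X) (h' : Y ⟶ Z⟦(-1 : ℤ)⟧⟦(1 : ℤ)⟧),
      Triangle.mk f' f h' ∈ distTriang C ∧ ∀ (V : C) (p : V ⟶ Y), p ≫ g = 0 → p ≫ h' = 0 :=
  ⟨_, g ≫ (shiftEquiv C (1 : ℤ)).counitIso.inv.app _, inv_rot_of_distTriang _ hT,
    fun _ p hp => (Category.assoc p g _).symm.trans ((congrArg (· ≫ _) hp).trans zero_comp)⟩

variable [IsTriangulated C]

/-- `index (Σ⁻¹N) + index N` only depends on the behaviour of `N` under `Hom(S, -)`. -/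
lemma indexSum_eq_of_bijective {N K : C} (h : N ⟶ K)
    (hinj : ∀ V : C, S V → ∀ p : V ⟶ N, p ≫ h = 0 → p = 0)
    (hsurj : ∀ V : C, S V → ∀ p : V ⟶ K, ∃ q : V ⟶ N, q ≫ h = p) :
    indexSum hS hd N = indexSum hS hd K := by
  obtain ⟨W, w, δ, hT⟩ := distinguished_cocone_triangle₁ h
  have h₁ : index hS hd N = index hS hd W + index hS hd K := index_triangle hT fun V hV p => by
    obtain ⟨q, rfl⟩ := hsurj V hV p
    rw [Category.assoc, distTriang_comp₂₃ hT, comp_zero]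
  obtain ⟨w', δ', hT', -⟩ := exists_inv_rotate hT
  obtain ⟨_, _, hT'', hδ⟩ := exists_inv_rotate hT'
  have h₂ := index_triangle (hS := hS) (hd := hd) hT'' fun V hV p => hδ V p <| hinj V hV _ <| by
    rw [Category.assoc, distTriang_comp₁₂ hT, comp_zero]
  rw [indexSum, indexSum, h₁, h₂]
  abel

lemma indexSum_triangle {X Y Z : C} {f : X ⟶ Y} {g : Y ⟶ Z} {h : Z ⟶ X⟦(1 : ℤ)⟧}
    (hT : Triangle.mk f g h ∈ distTriang C)
    (hinj : ∀ V : C, S V → ∀ p : V ⟶ X, p ≫ f = 0 → p = 0)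
    (hsurj : ∀ V : C, S V → ∀ p : V ⟶ Z, ∃ q : V ⟶ Y, q ≫ g = p) :
    indexSum hS hd Y = indexSum hS hd X + indexSum hS hd Z := by
  have h₁ : index hS hd Y = index hS hd X + index hS hd Z := index_triangle hT fun V hV p => by
    obtain ⟨q, rfl⟩ := hsurj V hV p
    rw [Category.assoc, distTriang_comp₂₃ hT, comp_zero]
  obtain ⟨_, _, hT', -⟩ := exists_inv_rotate hT
  obtain ⟨_, _, hT'', -⟩ := exists_inv_rotate hT'
  obtain ⟨_, _, hT₃, hδ⟩ := exists_inv_rotate hT''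
  have h₂ := index_triangle (hS := hS) (hd := hd) hT₃ fun V hV p => hδ V p <| hinj V hV _ <| by
    rw [Category.assoc, distTriang_comp₁₂ hT', comp_zero]
  rw [indexSum, indexSum, indexSum, h₁, h₂]
  abel

/-- On the cone of `P ⟶ Q` in `S`, the sum of the two indices is the alternating sum of an angle. -/
lemma indexSum_cone (hd' : 2 ≤ d) {N : C} {P Q : S.FullSubcategory} {f : P.obj ⟶ Q.obj}
    {g : Q.obj ⟶ N} {h : N ⟶ P.obj⟦(1 : ℤ)⟧} (hT : Triangle.mk f g h ∈ distTriang C) :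
    indexSum hS hd N = splitClass Q - splitClass P + index hS hd (N⟦(-1 : ℤ)⟧) := by
  have h₁ := index_triangle (hS := hS) (hd := hd) hT fun V hV p =>
    hS.hom_shift_one hd' hV P.property _
  rw [index_of_mem, index_of_mem] at h₁
  rw [indexSum, h₁]
  abel

lemma indexSum_mem_angleRelations (hd' : 2 ≤ d) {N : C} {P Q : S.FullSubcategory}
    {f : P.obj ⟶ Q.obj} {g : Q.obj ⟶ N} {h : N ⟶ P.obj⟦(1 : ℤ)⟧}
    (hT : Triangle.mk f g h ∈ distTriang C) : indexSum hS hd N ∈ angleRelations S d := by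
  rw [indexSum_cone hd' hT]
  exact HasResolution.mem_angleRelations hd (inv_rot_of_distTriang _ hT) (hasResolution_index _)

end IndexSum

/-! ### Coherent modules as cones -/

section Functors

variable {k : Type w} [Field k] {J : Type u} [Category.{v} J] {A B D : J ⥤ ModuleCat.{v} k}

lemma nonempty_iso_of_ker_eq (p : A ⟶ B) (q : A ⟶ D)
    (hp : ∀ X, Function.Surjective (p.app X).hom) (hq : ∀ X, Function.Surjective (q.app X).hom)
    (h : ∀ X (a : A.obj X), (p.app X).hom a = 0 ↔ (q.app X).hom a = 0) : Nonempty (B ≅ D) := by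
  have : ∀ X, Epi (p.app X) := fun X => (ModuleCat.epi_iff_surjective _).2 (hp X)
  have : ∀ X, Epi (q.app X) := fun X => (ModuleCat.epi_iff_surjective _).2 (hq X)
  have : Epi p := NatTrans.epi_of_epi_app p
  have : Epi q := NatTrans.epi_of_epi_app q
  have h₁ : kernel.ι p ≫ q = 0 := by
    ext X a
    exact (h X _).1 (congrArg (fun r => (r.app X).hom a) (kernel.condition p))
  have h₂ : kernel.ι q ≫ p = 0 := by
    ext X a
    exact (h X _).2 (congrArg (fun r => (r.app X).hom a) (kernel.condition q))
  refine ⟨⟨Abelian.epiDesc p q h₁, Abelian.epiDesc q p h₂, ?_, ?_⟩⟩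
  · rw [← cancel_epi p]; simp
  · rw [← cancel_epi q]; simp

lemma nonempty_iso_of_range_eq (i : A ⟶ D) (j : B ⟶ D)
    (hi : ∀ X, Function.Injective (i.app X).hom) (hj : ∀ X, Function.Injective (j.app X).hom)
    (h : ∀ X (a : D.obj X), (∃ b, (i.app X).hom b = a) ↔ (∃ b, (j.app X).hom b = a)) :
    Nonempty (A ≅ B) := by
  have : ∀ X, Mono (i.app X) := fun X => (ModuleCat.mono_iff_injective _).2 (hi X)
  have : ∀ X, Mono (j.app X) := fun X => (ModuleCat.mono_iff_injective _).2 (hj X)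
  have : Mono i := NatTrans.mono_of_mono_app i
  have : Mono j := NatTrans.mono_of_mono_app j
  have h₁ : i ≫ cokernel.π j = 0 := by
    ext X a
    obtain ⟨b, hb⟩ := (h X _).1 ⟨a, rfl⟩
    change ((cokernel.π j).app X).hom ((i.app X).hom a) = 0
    rw [← hb]
    exact congrArg (fun r => (r.app X).hom b) (cokernel.condition j)
  have h₂ : j ≫ cokernel.π i = 0 := by
    ext X a
    obtain ⟨b, hb⟩ := (h X _).2 ⟨a, rfl⟩
    change ((cokernel.π i).app X).hom ((j.app X).hom a) = 0
    rw [← hb]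
    exact congrArg (fun r => (r.app X).hom b) (cokernel.condition i)
  refine ⟨⟨Abelian.monoLift j i h₁, Abelian.monoLift i j h₂, ?_, ?_⟩⟩
  · rw [← cancel_mono i]; simp
  · rw [← cancel_mono j]; simp

end Functors

section Coherent

variable {k : Type w} [Field k] {C : Type u} [Category.{v} C] [Preadditive C] [Linear k C]
  {S : ObjectProperty C}

variable (k S) in
/-- The functoriality of `F_S`. -/
noncomputable def restrictedYonedaMap {N K : C} (h : N ⟶ K) :
    restrictedYoneda k S N ⟶ restrictedYoneda k S K :=
  Functor.whiskerLeft S.ι.op ((linearYoneda k C).map h)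

/-- The Yoneda lemma. -/
lemma exists_eq_restrictedYonedaMap {U : S.FullSubcategory} {K : C}
    (φ : restrictedYoneda k S U.obj ⟶ restrictedYoneda k S K) :
    ∃ h : U.obj ⟶ K, φ = restrictedYonedaMap k S h := by
  refine ⟨(φ.app (Opposite.op U)).hom (𝟙 U.obj), ?_⟩
  ext V p
  have h := congrArg (fun r => r.hom (𝟙 U.obj))
    (φ.naturality (ObjectProperty.homMk (X := V.unop) (Y := U) p).op)
  exact (congrArg _ (Category.comp_id (X := V.unop.obj) p).symm).trans h

variable [HasZeroObject C] [HasShift C ℤ] [∀ n : ℤ, (shiftFunctor C n).Additive]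
  [Pretriangulated C] {d : ℕ}

variable (k) in
/-- `F_S(-)` turns the triangle of a cone of a morphism in `S` into a presentation. -/
lemma restrictedYoneda_presentation (hS : IsClusterTilting S d) (hd' : 2 ≤ d) {N : C}
    {P Q : S.FullSubcategory} {f : P.obj ⟶ Q.obj} {g : Q.obj ⟶ N} {h : N ⟶ P.obj⟦(1 : ℤ)⟧}
    (hT : Triangle.mk f g h ∈ distTriang C) (X : S.FullSubcategoryᵒᵖ) :
    Function.Exact ((restrictedYonedaMap k S f).app X).hom ((restrictedYonedaMap k S g).app X).hom ∧
      Function.Surjective ((restrictedYonedaMap k S g).app X).hom := by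
  refine ⟨fun p => ⟨fun hp => distTriang_lift₁ hT p hp, ?_⟩, fun p => ?_⟩
  · rintro ⟨p, rfl⟩
    exact (Category.assoc (p : X.unop.obj ⟶ P.obj) f g).trans
      ((congrArg _ (distTriang_comp₁₂ hT)).trans comp_zero)
  · exact distTriang_lift₂ hT p (hS.hom_shift_one hd' X.unop.property P.property _)

lemma isCoherent_of_triangle (hS : IsClusterTilting S d) (hd' : 2 ≤ d) {N : C}
    {P Q : S.FullSubcategory} {f : P.obj ⟶ Q.obj} {g : Q.obj ⟶ N} {h : N ⟶ P.obj⟦(1 : ℤ)⟧}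
    (hT : Triangle.mk f g h ∈ distTriang C) : IsCoherent k S (restrictedYoneda k S N) where
  additive := ⟨fun {X Y a b} => by
    ext p
    exact Preadditive.add_comp _ _ _ a.unop.hom b.unop.hom p⟩
  linear r f := by
    ext p
    exact Linear.smul_comp _ _ _ r f.hom p
  presentation := ⟨P, Q, _, _, restrictedYoneda_presentation k hS hd' hT⟩

/-- Every coherent module is `F_S N` for the cone `N` of a morphism in `S`. -/
lemma IsCoherent.exists_iso (hS : IsClusterTilting S d) (hd' : 2 ≤ d)
    {G : S.FullSubcategoryᵒᵖ ⥤ ModuleCat.{v} k} (hG : IsCoherent k S G) :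
    ∃ N : C, S.extensionProduct (S.map (shiftFunctor C (1 : ℤ))) N ∧
      Nonempty (restrictedYoneda k S N ≅ G) := by
  obtain ⟨P, Q, f, p, h⟩ := hG.presentation
  obtain ⟨f, rfl⟩ := exists_eq_restrictedYonedaMap f
  obtain ⟨N, g, δ, hT⟩ := distinguished_cocone_triangle f
  have h' := restrictedYoneda_presentation k hS hd' hT
  exact ⟨N, extensionProduct_of_triangle hT, nonempty_iso_of_ker_eq _ p (fun X => (h' X).2)
    (fun X => (h X).2) fun X a => ((h' X).1 a).trans ((h X).1 a).symm⟩

/-- `F_S` is full on morphisms whose source is the cone of a morphism in `S`. -/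
lemma exists_eq_restrictedYonedaMap_of_triangle (hS : IsClusterTilting S d) (hd' : 2 ≤ d)
    {N K : C} (hN : S.extensionProduct (S.map (shiftFunctor C (1 : ℤ))) N)
    (φ : restrictedYoneda k S N ⟶ restrictedYoneda k S K) :
    ∃ h : N ⟶ K, φ = restrictedYonedaMap k S h := by
  obtain ⟨P, Q, f, g, δ, hT⟩ := exists_triangle_of_extensionProduct hS hN
  obtain ⟨a, ha⟩ := exists_eq_restrictedYonedaMap (restrictedYonedaMap k S g ≫ φ)
  have ha' : ∀ (V : S.FullSubcategory) (p : V.obj ⟶ Q.obj),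
      (φ.app (Opposite.op V)).hom (p ≫ g : V.obj ⟶ N) = (p ≫ a : V.obj ⟶ K) := fun V p =>
    congrArg (fun r => (r.app (Opposite.op V)).hom p) ha
  obtain ⟨h, rfl⟩ := distTriang_desc₃ hT a (by
    rw [← ha' P f, distTriang_comp₁₂ hT]
    exact map_zero _)
  refine ⟨h, ?_⟩
  ext V p
  obtain ⟨q, rfl⟩ := distTriang_lift₂ hT p
    (hS.hom_shift_one hd' V.unop.property P.property _)
  exact (ha' V.unop q).trans (Category.assoc q g h).symm

end Coherent

/-! ### The homomorphism `θ` -/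

/-- A morphism to `N` from an object of `ΣS` through which all such morphisms factor. -/
lemma exists_shift_precover {C : Type u} [Category.{v} C] [HasShift C ℤ]
    (S : ObjectProperty C) (h : ∀ X : C, ∃ (U : C) (ν : U ⟶ X), IsPrecover S ν)
    (N : C) :
    ∃ (Q : C) (q : Q⟦(1 : ℤ)⟧ ⟶ N), S Q ∧
      ∀ V : C, S V → ∀ t : V⟦(1 : ℤ)⟧ ⟶ N, ∃ c : V⟦(1 : ℤ)⟧ ⟶ Q⟦(1 : ℤ)⟧, c ≫ q = t := by
  obtain ⟨Q, ν, hν⟩ := h (N⟦(-1 : ℤ)⟧)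
  let e : N⟦(-1 : ℤ)⟧⟦(1 : ℤ)⟧ ≅ N := (shiftEquiv C (1 : ℤ)).counitIso.app N
  refine ⟨Q, ν⟦(1 : ℤ)⟧' ≫ e.hom, hν.1, fun V hV t => ?_⟩
  obtain ⟨s, hs⟩ := (shiftFunctor C (1 : ℤ)).map_surjective (t ≫ e.inv)
  obtain ⟨c, rfl⟩ := hν.2 V hV s
  refine ⟨c⟦(1 : ℤ)⟧', ?_⟩
  rw [← Category.assoc, ← Functor.map_comp, hs, Category.assoc, e.inv_hom_id, Category.comp_id]

section Theta

variable {k : Type w} [Field k] {C : Type u} [Category.{v} C] [Preadditive C] [Linear k C]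
  {S : ObjectProperty C}

lemma isShortExact_bicone {M₁ M₃ : CoherentModules k S} (b : BinaryBicone M₁ M₃)
    (hb : b.IsBilimit) : IsShortExact b.inl b.snd := by
  intro X
  have h₁ : ∀ x, (b.fst.hom.app X).hom ((b.inl.hom.app X).hom x) = x := fun x =>
    congrArg (fun r => (r.hom.app X).hom x) b.inl_fst
  have h₂ : ∀ x, (b.snd.hom.app X).hom ((b.inl.hom.app X).hom x) = 0 := fun x =>
    congrArg (fun r => (r.hom.app X).hom x) b.inl_snd
  have h₃ : ∀ x, (b.snd.hom.app X).hom ((b.inr.hom.app X).hom x) = x := fun x =>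
    congrArg (fun r => (r.hom.app X).hom x) b.inr_snd
  have h₄ : ∀ y, (b.inl.hom.app X).hom ((b.fst.hom.app X).hom y) +
      (b.inr.hom.app X).hom ((b.snd.hom.app X).hom y) = y := fun y =>
    congrArg (fun r => (r.hom.app X).hom y) (IsBilimit.binary_total hb)
  refine ⟨Function.LeftInverse.injective h₁, fun y => ⟨fun hy => ?_, ?_⟩, fun z => ⟨_, h₃ z⟩⟩
  · refine ⟨(b.fst.hom.app X).hom y, ?_⟩
    conv_rhs => rw [← h₄ y, hy, map_zero, add_zero]
  · rintro ⟨x, rfl⟩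
    exact h₂ x

lemma modHom_ext {G : Type*} [AddCommGroup G] {α β : K0Mod k S →+ G}
    (h : ∀ M, α (modClass M) = β (modClass M)) : α = β :=
  QuotientAddGroup.addMonoidHom_ext _ (splitHom_ext h)

variable [HasZeroObject C] [HasShift C ℤ]
  [∀ n : ℤ, (shiftFunctor C n).Additive] [Pretriangulated C] {d : ℕ}

variable (k S) in
/-- The modules `F_S N`, for `N` in `S * ΣS`, as objects of `mod S`. -/
noncomputable def coherentOf (hS : IsClusterTilting S d) (hd' : 2 ≤ d) (N : C)
    (hN : S.extensionProduct (S.map (shiftFunctor C (1 : ℤ))) N) : CoherentModules k S :=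
  ⟨restrictedYoneda k S N, by
    obtain ⟨_, _, _, _, _, hT⟩ := exists_triangle_of_extensionProduct hS hN
    exact isCoherent_of_triangle hS hd' hT⟩

/-- An object `N` of `S * ΣS` with `F_S N ≅ M`. -/
noncomputable def coneOf (hS : IsClusterTilting S d) (hd' : 2 ≤ d) (M : CoherentModules k S) : C :=
  (M.property.exists_iso hS hd').choose

lemma coneOf_mem (hS : IsClusterTilting S d) (hd' : 2 ≤ d) (M : CoherentModules k S) :
    S.extensionProduct (S.map (shiftFunctor C (1 : ℤ))) (coneOf hS hd' M) :=
  (M.property.exists_iso hS hd').choose_spec.1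

/-- The chosen isomorphism `F_S N ≅ M` for `N = coneOf M`. -/
noncomputable def coneOfIso (hS : IsClusterTilting S d) (hd' : 2 ≤ d) (M : CoherentModules k S) :
    restrictedYoneda k S (coneOf hS hd' M) ≅ M.obj :=
  (M.property.exists_iso hS hd').choose_spec.2.some

lemma modClass_eq (hS : IsClusterTilting S d) (hd' : 2 ≤ d) (M : CoherentModules k S) :
    modClass M = modClass (coherentOf k S hS hd' _ (coneOf_mem hS hd' M)) :=
  congrArg QuotientAddGroup.mk (splitClass_congr (ObjectProperty.isoMk _ (coneOfIso hS hd' M).symm))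

variable [IsTriangulated C] {hS : IsClusterTilting S d} {hd : 1 ≤ d}

lemma indexSum_eq_of_iso (hd' : 2 ≤ d) {N K : C}
    (hN : S.extensionProduct (S.map (shiftFunctor C (1 : ℤ))) N)
    (e : restrictedYoneda k S N ≅ restrictedYoneda k S K) :
    indexSum hS hd N = indexSum hS hd K := by
  obtain ⟨h, hh⟩ := exists_eq_restrictedYonedaMap_of_triangle hS hd' hN e.hom
  have hb : ∀ V : S.FullSubcategory,
      Function.Bijective fun p : V.obj ⟶ N => (p ≫ h : V.obj ⟶ K) := fun V => by
    have h₁ := (e.app (Opposite.op V)).toLinearEquiv.bijective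
    have h₂ : ⇑(e.app (Opposite.op V)).toLinearEquiv = fun p : V.obj ⟶ N => (p ≫ h : V.obj ⟶ K) :=
      funext fun p => congrArg (fun r => (r.app (Opposite.op V)).hom p) hh
    exact h₂ ▸ h₁
  refine indexSum_eq_of_bijective h (fun V hV p hp => (hb ⟨V, hV⟩).1 ?_)
    fun V hV p => (hb ⟨V, hV⟩).2 p
  change p ≫ h = 0 ≫ h
  rw [hp, zero_comp]

/-- A short exact sequence `0 ⟶ F_S N₁ ⟶ F_S N₂ ⟶ F_S N₃ ⟶ 0` lifts to a triangle after adding to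
`N₂` an object of `ΣS`, which `F_S` annihilates. -/
theorem indexSum_of_exact (hd' : 2 ≤ d) {N₁ N₂ N₃ : C}
    (h₁ : S.extensionProduct (S.map (shiftFunctor C (1 : ℤ))) N₁)
    (h₂ : S.extensionProduct (S.map (shiftFunctor C (1 : ℤ))) N₂)
    (φ : restrictedYoneda k S N₁ ⟶ restrictedYoneda k S N₂)
    (ψ : restrictedYoneda k S N₂ ⟶ restrictedYoneda k S N₃)
    (hφ : ∀ X, Function.Injective (φ.app X).hom)
    (hφψ : ∀ X, Function.Exact (φ.app X).hom (ψ.app X).hom)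
    (hψ : ∀ X, Function.Surjective (ψ.app X).hom) :
    indexSum hS hd N₂ = indexSum hS hd N₁ + indexSum hS hd N₃ := by
  obtain ⟨h, rfl⟩ := exists_eq_restrictedYonedaMap_of_triangle hS hd' h₂ ψ
  obtain ⟨Q, q, hQ, hq⟩ := exists_shift_precover S hS.functoriallyFinite.1 N₃
  let m : N₂ ⊞ Q⟦(1 : ℤ)⟧ ⟶ N₃ := biprod.desc h q
  obtain ⟨K, i, δ, hT⟩ := distinguished_cocone_triangle₁ m
  have hsnd : ∀ V : C, S V → ∀ p : V ⟶ N₂ ⊞ Q⟦(1 : ℤ)⟧, p = (p ≫ biprod.fst) ≫ biprod.inl := by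
    intro V hV p
    have : p ≫ biprod.snd = 0 := hS.hom_shift_one hd' hV hQ _
    ext <;> simp [this]
  -- Adding `ΣQ` makes `Hom(V, Σ⁻¹(N₂ ⊕ ΣQ)) ⟶ Hom(V, Σ⁻¹N₃)` surjective, for all `V` in `S`.
  have hinj : ∀ V : C, S V → ∀ p : V ⟶ K, p ≫ i = 0 → p = 0 := by
    intro V hV p hp
    obtain ⟨t, ht⟩ := distTriang_lift₃ hT (p⟦(1 : ℤ)⟧') (by
      rw [← Functor.map_comp, hp, Functor.map_zero])
    obtain ⟨c, rfl⟩ := hq V hV t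
    have hq' : q = biprod.inr ≫ m := biprod.inr_desc _ _ |>.symm
    rw [hq', Category.assoc, Category.assoc, distTriang_comp₂₃ hT, comp_zero, comp_zero] at ht
    exact (shiftFunctor C (1 : ℤ)).map_injective (ht.symm.trans (Functor.map_zero _ _ _).symm)
  have hsurj : ∀ V : C, S V → ∀ p : V ⟶ N₃, ∃ a : V ⟶ N₂, a ≫ h = p := fun V hV p =>
    hψ (Opposite.op ⟨V, hV⟩) p
  have e₁ : indexSum hS hd N₂ = indexSum hS hd (N₂ ⊞ Q⟦(1 : ℤ)⟧) :=
    indexSum_eq_of_bijective biprod.inl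
      (fun V hV p hp => by rw [← cancel_mono (biprod.inl : N₂ ⟶ N₂ ⊞ Q⟦(1 : ℤ)⟧), hp, zero_comp])
      fun V hV p => ⟨p ≫ biprod.fst, (hsnd V hV p).symm⟩
  have e₂ : indexSum hS hd (N₂ ⊞ Q⟦(1 : ℤ)⟧) = indexSum hS hd K + indexSum hS hd N₃ :=
    indexSum_triangle hT hinj fun V hV p => by
      obtain ⟨a, rfl⟩ := hsurj V hV p
      exact ⟨a ≫ biprod.inl, by rw [Category.assoc, biprod.inl_desc]⟩
  -- `F_S N₁` and `F_S K` are the same submodule of `F_S N₂`.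
  obtain ⟨e⟩ := nonempty_iso_of_range_eq φ (restrictedYonedaMap k S (i ≫ biprod.fst)) hφ
    (fun X => by
      refine (injective_iff_map_eq_zero _).2 fun (p : X.unop.obj ⟶ K) hp => ?_
      have hp' : p ≫ i ≫ biprod.fst = 0 := hp
      refine hinj _ X.unop.property p ?_
      rw [hsnd _ X.unop.property (p ≫ i), Category.assoc p, hp', zero_comp])
    (fun X (a : X.unop.obj ⟶ N₂) => by
      refine (hφψ X a).symm.trans ?_
      change a ≫ h = 0 ↔ ∃ b : X.unop.obj ⟶ K, b ≫ i ≫ biprod.fst = a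
      constructor
      · intro ha
        obtain ⟨b, hb⟩ := distTriang_lift₁ hT (a ≫ biprod.inl) (by
          rw [Category.assoc, biprod.inl_desc, ha])
        exact ⟨b, by rw [← Category.assoc, hb, Category.assoc, biprod.inl_fst, Category.comp_id]⟩
      · rintro ⟨b, rfl⟩
        have hb : (b ≫ i) ≫ m = 0 := by
          rw [Category.assoc, distTriang_comp₁₂ hT, comp_zero]
        rw [hsnd _ X.unop.property (b ≫ i), Category.assoc, biprod.inl_desc] at hb
        simpa only [Category.assoc] using hb)
  rw [e₁, e₂, indexSum_eq_of_iso hd' h₁ e]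

lemma indexSum_coneOf (hd' : 2 ≤ d) {N : C} (M : CoherentModules k S)
    (e : M.obj ≅ restrictedYoneda k S N) :
    indexSum hS hd (coneOf hS hd' M) = indexSum hS hd N :=
  indexSum_eq_of_iso hd' (coneOf_mem hS hd' M) (coneOfIso hS hd' M ≪≫ e)

lemma indexSum_coneOf_of_isShortExact (hd' : 2 ≤ d) {M₁ M₂ M₃ : CoherentModules k S}
    {f : M₁ ⟶ M₂} {g : M₂ ⟶ M₃} (hfg : IsShortExact f g) :
    indexSum hS hd (coneOf hS hd' M₂) =
      indexSum hS hd (coneOf hS hd' M₁) + indexSum hS hd (coneOf hS hd' M₃) := by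
  let e₁ := coneOfIso hS hd' M₁
  let e₂ := coneOfIso hS hd' M₂
  let e₃ := coneOfIso hS hd' M₃
  have b₁ := fun X => (e₁.app X).toLinearEquiv.bijective
  have b₂ := fun X => (e₂.app X).toLinearEquiv.bijective
  have b₂' := fun X => (e₂.app X).toLinearEquiv.symm.bijective
  have b₃' := fun X => (e₃.app X).toLinearEquiv.symm.bijective
  refine indexSum_of_exact hd' (coneOf_mem hS hd' M₁) (coneOf_mem hS hd' M₂)
    (e₁.hom ≫ f.hom ≫ e₂.inv) (e₂.hom ≫ g.hom ≫ e₃.inv)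
    (fun X => (b₂' X).1.comp ((hfg X).1.comp (b₁ X).1)) (fun X y => ?_)
    (fun X => (b₃' X).2.comp ((hfg X).2.2.comp (b₂ X).2))
  have h := (hfg X).2.1 ((e₂.hom.app X).hom y)
  constructor
  · intro hy
    obtain ⟨x, hx⟩ := h.1 ((b₃' X).1 (hy.trans (map_zero _).symm))
    obtain ⟨x, rfl⟩ := (b₁ X).2 x
    exact ⟨x, (congrArg (e₂.app X).toLinearEquiv.symm hx).trans
      ((e₂.app X).toLinearEquiv.symm_apply_apply y)⟩
  · rintro ⟨x, rfl⟩
    refine (congrArg (e₃.app X).toLinearEquiv.symm (h.2 ⟨(e₁.hom.app X).hom x, ?_⟩)).trans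
      (map_zero _)
    exact ((e₂.app X).toLinearEquiv.apply_symm_apply _).symm

variable (k hS hd) in
/-- The homomorphism `θ_S`, sending `[F_S N]` to `index (Σ⁻¹N) + index N`. -/
noncomputable def theta (hd' : 2 ≤ d) : K0Mod k S →+ K0Split S.FullSubcategory :=
  QuotientAddGroup.lift _
    (splitLift (fun M : CoherentModules k S => indexSum hS hd (coneOf hS hd' M))
      (fun {M M'} e => indexSum_coneOf hd' M
        (((ObjectProperty.ι _).mapIso e) ≪≫ (coneOfIso hS hd' M').symm))
      (fun b hb => indexSum_coneOf_of_isShortExact hd' (isShortExact_bicone b hb)))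
    (by
      refine (AddSubgroup.closure_le _).2 ?_
      rintro _ ⟨M₁, M₂, M₃, f, g, hfg, rfl⟩
      change splitLift _ _ _ _ = 0
      rw [map_add, map_sub, splitLift_splitClass, splitLift_splitClass, splitLift_splitClass,
        indexSum_coneOf_of_isShortExact hd' hfg]
      abel)

lemma theta_modClass (hd' : 2 ≤ d) (M : CoherentModules k S) :
    theta k hS hd hd' (modClass M) = indexSum hS hd (coneOf hS hd' M) :=
  FreeAbelianGroup.lift_apply_of _ _

lemma isTheta_theta (hd' : 2 ≤ d) : IsTheta k (index hS hd) (theta k hS hd hd') := fun N hN =>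
  ⟨(coherentOf k S hS hd' N hN).property, (theta_modClass hd' _).trans
    (indexSum_coneOf hd' (coherentOf k S hS hd' N hN) (Iso.refl _))⟩

lemma theta_unique (hd' : 2 ≤ d) {θ : K0Mod k S →+ K0Split S.FullSubcategory}
    (hθ : IsTheta k (index hS hd) θ) : θ = theta k hS hd hd' := by
  refine modHom_ext fun M => ?_
  obtain ⟨_, h⟩ := hθ _ (coneOf_mem hS hd' M)
  rw [theta_modClass, modClass_eq hS hd' M]
  exact h

/-- The image of `θ_S` is the subgroup of the relations given by the angles: the cones of the
morphisms `U₁ ⟶ U₀` in `S` correspond to the angles starting with `U₁ ⟶ U₀`. -/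
theorem range_theta (hd' : 2 ≤ d) : (theta k hS hd hd').range = angleRelations S d := by
  apply le_antisymm
  · rintro _ ⟨x, rfl⟩
    obtain ⟨x, rfl⟩ := QuotientAddGroup.mk_surjective x
    refine splitClass_induction
      (p := fun x => theta k hS hd hd' (QuotientAddGroup.mk x) ∈ angleRelations S d) x ?_
      (fun M => ?_) fun x y hx hy => ?_
    · exact (map_zero (theta k hS hd hd')).symm ▸ zero_mem _
    · obtain ⟨_, _, _, _, _, hT⟩ := exists_triangle_of_extensionProduct hS (coneOf_mem hS hd' M)
      exact (theta_modClass (hS := hS) (hd := hd) hd' M).symm ▸ indexSum_mem_angleRelations hd' hT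
    · rw [QuotientAddGroup.mk_sub, map_sub]
      exact sub_mem hx hy
  · rw [angleRelations_eq_closure, AddSubgroup.closure_le]
    rintro _ ⟨Q, x, hx, rfl⟩
    obtain ⟨n, rfl⟩ := Nat.exists_eq_add_of_le' hd
    obtain ⟨⟩ | @⟨_, _, Y, y, U, ι, μ, δ, hT, _, hY⟩ := hx
    have hy : index hS hd Y = y := index_eq (hY.precovers_of_lt hS le_rfl).1
    have hT' : Triangle.mk μ δ (-ι⟦(1 : ℤ)⟧') ∈ distTriang C := rot_of_distTriang _ hT
    let N : C := Y⟦(1 : ℤ)⟧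
    have hN : S.extensionProduct (S.map (shiftFunctor C (1 : ℤ))) N :=
      extensionProduct_of_triangle hT'
    obtain ⟨_, h⟩ := isTheta_theta (k := k) (hS := hS) (hd := hd) hd' N hN
    refine ⟨_, h.trans ?_⟩
    change indexSum hS hd N = _
    have hN' : index hS hd (N⟦(-1 : ℤ)⟧) = index hS hd Y :=
      index_congr ((shiftEquiv C (1 : ℤ)).unitIso.symm.app Y)
    rw [indexSum_cone hd' hT', hN', hy]
    abel

end Theta

end ClusterK0

open ClusterK0
theorem theoremC {k : Type w} [Field k]
    {C : Type u} [Category.{v} C] [Preadditive C] [HasZeroObject C] [HasShift C ℤ]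
    [∀ n : ℤ, (shiftFunctor C n).Additive] [Pretriangulated C] [IsTriangulated C]
    [Linear k C] [∀ n : ℤ, Functor.Linear k (shiftFunctor C n)]
    [∀ X Y : C, Module.Finite k (X ⟶ Y)] [IsIdempotentComplete C]
    (S : ObjectProperty C) (d : ℕ) (hd : 1 ≤ d)
    (hS : IsClusterTilting S d)
    (hshift : S.map (shiftFunctor C (d : ℤ)) = S) :
    (∃ e : K0Angulated S d ≃+ K0Triangulated C,
      ∀ X : S.FullSubcategory, e (angulatedClass d X) = triangulatedClass X.obj) ∧
    (2 ≤ d →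
      ∃ ind : C → K0Split S.FullSubcategory, IsIndexFunction S d ind ∧
        ∃ θ : K0Mod k S →+ K0Split S.FullSubcategory, IsTheta k ind θ ∧
          (∀ θ' : K0Mod k S →+ K0Split S.FullSubcategory, IsTheta k ind θ' → θ' = θ) ∧
          θ.range = angleRelations S d) := by
  refine ⟨⟨angulatedEquivTriangulated hS hd, angulatedEquivTriangulated_angulatedClass⟩,
    fun hd' => ⟨index hS hd, isIndexFunction_index k, theta k hS hd hd', isTheta_theta hd',
      fun _ hθ => theta_unique hd' hθ, range_theta hd'⟩⟩
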